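/- Let $S$ be a finite set of points in the Euclidean plane in convex position (no point of $S$ lies in the convex hull of the others). An edge is a straight-line segment between two distinct points of $S$; two distinct edges cross if they share a point interior to both. An odd matching on $S$ is a set of pairwise non-crossing edges, no two with a common endpoint, that covers all points of $S$ except exactly one, its isolated point. A flip removes one edge of an odd matching and inserts a new edge incident to the isolated point so that the result is again an odd matching (in particular crossing-free). The flip graph has the odd matchings on $S$ as vertices and joins two of them if they differ by one flip; the flip distance of two odd matchings is the length of a shortest path between them in the flip graph. Let $M$ and $M'$ be odd matchings on $S$. The edges of $M\cap M'$ are called happy. A happy edge $e$ is good if it lies on the boundary of the convex hull of $S$, or if all edges of $M\cup M'$ whose endpoints lie strictly on the side of $e$ that does not contain the isolated point are happy (the isolated points of $M$ and of $M'$ always lie on the same side of $e$). A happy edge that is not good is bad. Recall that $M\cup M'$ is a disjoint union of happy edges, of even cycles that alternate between edges of $M$ and $M'$, and of one alternating path (possibly of length zero) from the isolated point of $M$ to that of $M'$. Let $B$ be the set of bad happy edges, $C$ the set of edges of $M$ on the alternating cycles, $c$ the number of these cycles, and $D$ the set of edges of $M$ on the alternating path. **Theorem.** If $M\cup M'$ is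 crossing-free, then $M$ and $M'$ are connected by a path in the flip graph, and their flip distance is exactly $$2|B|+|C|+c+|D|.$$ -/

import Mathlib

/-- The Euclidean plane. -/
abbrev EPlane : Type := EuclideanSpace ℝ (Fin 2)

namespace PlaneEdge

variable {S : Finset EPlane}

/-- The open straight-line segment between the two endpoints of an edge. -/
noncomputable def openSeg (e : Sym2 S) : Set EPlane :=
  Sym2.lift ⟨fun a b : S => openSegment ℝ (a : EPlane) (b : EPlane),
    fun a b => openSegment_symm ℝ (a : EPlane) (b : EPlane)⟩ e

/-- The closed straight-line segment between the two endpoints of an edge. -/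
noncomputable def seg (e : Sym2 S) : Set EPlane :=
  Sym2.lift ⟨fun a b : S => segment ℝ (a : EPlane) (b : EPlane),
    fun a b => segment_symm ℝ (a : EPlane) (b : EPlane)⟩ e

/-- The straight line through the two endpoints of an edge. -/
noncomputable def line (e : Sym2 S) : AffineSubspace ℝ EPlane :=
  affineSpan ℝ ((fun v : S => (v : EPlane)) '' {v | v ∈ e})

/-- Two distinct edges cross if they have a common point that is interior to both segments. -/
def Cross (e f : Sym2 S) : Prop :=
  e ≠ f ∧ (openSeg e ∩ openSeg f).Nonempty

/-- A set of edges is crossing-free if no two of its edges cross. -/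
def CrossingFree (E : Set (Sym2 S)) : Prop :=
  ∀ e ∈ E, ∀ f ∈ E, ¬ Cross e f

/-- The edge is on (the boundary of) the convex hull of the point set. -/
def OnHull (e : Sym2 S) : Prop :=
  seg e ⊆ frontier (convexHull ℝ (S : Set EPlane))

end PlaneEdge

/-- An odd matching on a finite point set `S` in the plane: a set of edges between distinct points
of `S`, pairwise without common endpoints and pairwise non-crossing, that covers all points of `S`
but exactly one. -/
@[ext]
structure OddMatching (S : Finset EPlane) where
  edges : Set (Sym2 S)
  not_isDiag : ∀ e ∈ edges, ¬ e.IsDiag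
  eq_of_common_endpoint : ∀ e ∈ edges, ∀ f ∈ edges, ∀ v : S, v ∈ e → v ∈ f → e = f
  crossingFree : PlaneEdge.CrossingFree edges
  existsUnique_isolated : ∃! v : S, ∀ e ∈ edges, v ∉ e

namespace OddMatching

variable {S : Finset EPlane}

/-- The unique point that is not covered by the matching. -/
noncomputable def isolated (M : OddMatching S) : S := M.existsUnique_isolated.choose

theorem isolated_notMem (M : OddMatching S) : ∀ e ∈ M.edges, M.isolated ∉ e :=
  M.existsUnique_isolated.choose_spec.1

theorem eq_isolated (M : OddMatching S) {v : S} (h : ∀ e ∈ M.edges, v ∉ e) : v = M.isolated :=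
  M.existsUnique_isolated.choose_spec.2 v h

/-- `N` arises from `M` by a flip: one edge is removed and a new edge, incident to the isolated
point of `M`, is inserted. As `N` is an odd matching, the result is plane again. -/
def IsFlip (M N : OddMatching S) : Prop :=
  ∃ e ∈ M.edges, ∃ f, f ∉ M.edges ∧ M.isolated ∈ f ∧ N.edges = insert f (M.edges \ {e})

theorem IsFlip.symm {M N : OddMatching S} (h : IsFlip M N) : IsFlip N M := by
  obtain ⟨e, he, f, hf, hi, hN⟩ := h
  have hfN : f ∈ N.edges := by rw [hN]; exact Set.mem_insert _ _
  have hef : e ≠ f := fun h => hf (h ▸ he)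
  refine ⟨f, hfN, e, ?_, ?_, ?_⟩
  · rw [hN]; simp [hef]
  · by_contra hne
    have h1 : N.isolated = M.isolated := by
      apply M.eq_isolated
      intro g hg hmem
      have hge : g ≠ e := fun h => hne (h ▸ hmem)
      exact N.isolated_notMem g (by rw [hN]; exact Set.mem_insert_of_mem _ ⟨hg, hge⟩) hmem
    exact N.isolated_notMem f hfN (h1 ▸ hi)
  · rw [hN]
    ext g
    simp only [Set.mem_insert_iff, Set.mem_sdiff, Set.mem_singleton_iff]
    constructor
    · intro hg
      by_cases hge : g = e
      · exact Or.inl hge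
      · exact Or.inr ⟨Or.inr ⟨hg, hge⟩, fun h => hf (h ▸ hg)⟩
    · rintro (rfl | ⟨rfl | hg, hgf⟩)
      · exact he
      · exact absurd rfl hgf
      · exact hg.1

theorem IsFlip.ne {M N : OddMatching S} (h : IsFlip M N) : M ≠ N := by
  rintro rfl
  obtain ⟨e, he, f, hf, hi, hN⟩ := h
  exact hf (by rw [hN]; exact Set.mem_insert _ _)

/-- The flip graph of the point set `S`. -/
def flipGraph (S : Finset EPlane) : SimpleGraph (OddMatching S) where
  Adj M N := IsFlip M N
  symm := ⟨fun _ _ h => h.symm⟩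
  loopless := ⟨fun _ h => h.ne rfl⟩

/-- The graph on `S` whose edges are the edges of `M ∪ M'`. -/
def unionGraph (M M' : OddMatching S) : SimpleGraph S :=
  SimpleGraph.fromEdgeSet (M.edges ∪ M'.edges)

/-- The happy edges: those that lie in both matchings. -/
def happy (M M' : OddMatching S) : Set (Sym2 S) := M.edges ∩ M'.edges

/-- The points of `S` that the line through `e` strictly separates from the isolated point of `M`.
If `e` is a happy edge of `M` and `M'` and `S` is in convex position, then the isolated points of
`M` and `M'` lie strictly on the same side of `e`, so this part of `S` is the one without them. -/
def otherPart (M : OddMatching S) (e : Sym2 S) : Set S :=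
  {v | (PlaneEdge.line e).SOppSide (M.isolated : EPlane) (v : EPlane)}

/-- The good happy edges: happy edges on the convex hull, and happy edges `e` such that all edges
of `M ∪ M'` in the part of the point set cut off by `e` from the isolated point are happy. -/
def goodHappy (M M' : OddMatching S) : Set (Sym2 S) :=
  {e | e ∈ happy M M' ∧
    (PlaneEdge.OnHull e ∨
      ∀ f ∈ M.edges ∪ M'.edges, (∀ v ∈ f, v ∈ otherPart M e) → f ∈ happy M M')}

/-- The bad happy edges: the happy edges that are not good. -/
def badHappy (M M' : OddMatching S) : Set (Sym2 S) := happy M M' \ goodHappy M M'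

/-- Consecutive edges of the list alternate between `M` and `M'`. -/
def Alternates (M M' : OddMatching S) (l : List (Sym2 S)) : Prop :=
  l.IsChain fun e f =>
    (e ∈ M.edges \ M'.edges ∧ f ∈ M'.edges \ M.edges) ∨
    (e ∈ M'.edges \ M.edges ∧ f ∈ M.edges \ M'.edges)

/-- The even alternating cycles in `M ∪ M'`, each given as its set of edges. -/
def altCycles (M M' : OddMatching S) : Set (Set (Sym2 S)) :=
  {Z | ∃ (v : S) (p : (unionGraph M M').Walk v v),
    p.IsCycle ∧ Even p.length ∧ Alternates M M' p.edges ∧ Z = {e | e ∈ p.edges}}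

/-- The edges of `M` that lie on even alternating cycles of `M ∪ M'`. -/
def cycleEdges (M M' : OddMatching S) : Set (Sym2 S) :=
  {e | e ∈ M.edges ∧ ∃ Z ∈ altCycles M M', e ∈ Z}

/-- The edges of `M` that lie on the alternating path of `M ∪ M'` (possibly of length zero) from
the isolated point of `M` to the isolated point of `M'`. -/
def pathEdges (M M' : OddMatching S) : Set (Sym2 S) :=
  {e | e ∈ M.edges ∧ ∃ p : (unionGraph M M').Walk M.isolated M'.isolated,
    p.IsPath ∧ Alternates M M' p.edges ∧ e ∈ p.edges}

end OddMatching

/-! The claimed distance is a potential in disguise. Let `k` be the number of connected components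
of `M ∪ M'`. Parity shows that one component is the path joining the two isolated points and that
every other one is a happy edge or an alternating cycle, so `k = 1 + |happy| + c`
(`numComponents_eq`). As `|M| = |C| + |D| + |happy|`, the formula equals `k + |M| - 1 - 2|good|`.

Lower bound: a flip changes one edge of the union. It merges at most two components, and whenever it
creates a happy edge it splits one off. Hence `k + |M| - 1 - 2|happy|`, increased by two for each
happy edge that must still be removed, drops by at most one per flip (`potential_le_length`). Every
bad edge must be removed at some time: while an edge stays, all flips happen on the side of the
isolated point, so the other side is frozen (`exists_notMem_of_badHappy`).

Upper bound: if `M ≠ M'` and the union is plane, some flip lowers the potential and keeps the union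
plane (`exists_isProgress`). Either it joins the isolated point `x` to a new component without
losing a good edge, or it inserts the path edge `x p` of `M'`: this may create one component, but it
also creates a good edge, which counts twice. The first kind needs a visible endpoint of an edge
that is not good; a longest such edge supplies it (`exists_visible`).

The geometry is used only through crossings and sides, which in convex position are those of chords
with numbered endpoints (`exists_angular_order`). -/

/-! ### Orientation and convex position -/

/-- Twice the signed area of the triangle `a b c`. -/
def orient (a b c : EPlane) : ℝ :=
  (b 0 - a 0) * (c 1 - a 1) - (b 1 - a 1) * (c 0 - a 0)

theorem orient_rotate (a b c : EPlane) : orient b c a = orient a b c := by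
  unfold orient; ring

theorem orient_swap (a b c : EPlane) : orient a c b = - orient a b c := by
  unfold orient; ring

theorem orient_self_left (a b : EPlane) : orient a b a = 0 := by
  unfold orient; ring

theorem orient_self_right (a b : EPlane) : orient a b b = 0 := by
  unfold orient; ring

theorem orient_add (p a b c : EPlane) :
    orient a b c = orient p a b + orient p b c + orient p c a := by
  unfold orient; ring

theorem orient_combo (a b c d : EPlane) {s t : ℝ} (h : s + t = 1) :
    orient a b (s • c + t • d) = s * orient a b c + t * orient a b d := by
  obtain rfl : s = 1 - t := by linarith
  simp only [orient, PiLp.add_apply, PiLp.smul_apply, smul_eq_mul]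
  ring

theorem orient_continuous (a b : EPlane) : Continuous (orient a b) := by
  unfold orient; fun_prop

/-- A point is the barycentric combination of a triangle with the signed areas as weights. -/
theorem orient_smul_combo (p a b c : EPlane) (h : orient a b c ≠ 0) :
    (orient p b c / orient a b c) • a + (orient p c a / orient a b c) • b
      + (orient p a b / orient a b c) • c = p := by
  ext i
  simp only [PiLp.add_apply, PiLp.smul_apply, smul_eq_mul]
  field_simp
  fin_cases i <;> simp [orient] <;> ring

theorem mem_convexHull_of_orient_pos {p a b c : EPlane} (h₁ : 0 < orient p a b)
    (h₂ : 0 < orient p b c) (h₃ : 0 < orient p c a) :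
    p ∈ convexHull ℝ ({a, b, c} : Set EPlane) := by
  have hs : 0 < orient a b c := by rw [orient_add p]; positivity
  have hp := orient_smul_combo p a b c hs.ne'
  rw [← hp]
  have hsum : orient p b c / orient a b c + orient p c a / orient a b c
      + orient p a b / orient a b c = 1 := by
    rw [← add_div, ← add_div, div_eq_one_iff_eq hs.ne', orient_add p a b c]; ring
  have key := (convex_convexHull ℝ ({a, b, c} : Set EPlane)).sum_mem (t := Finset.univ)
    (w := ![orient p b c / orient a b c, orient p c a / orient a b c, orient p a b / orient a b c])
    (z := ![a, b, c]) ?_ ?_ ?_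
  · simpa [Fin.sum_univ_three] using key
  · intro i _; fin_cases i <;> simp <;> positivity
  · simpa [Fin.sum_univ_three] using hsum
  · intro i _; fin_cases i <;> exact subset_convexHull ℝ _ (by simp)

theorem mem_affineSpan_pair_of_orient_eq_zero {a b c : EPlane} (hab : a ≠ b)
    (h : orient a b c = 0) : ∃ r : ℝ, c = AffineMap.lineMap a b r := by
  have : a 0 ≠ b 0 ∨ a 1 ≠ b 1 := by
    by_contra! hc
    exact hab (by ext i; fin_cases i; exacts [hc.1, hc.2])
  unfold orient at h
  rcases this with h0 | h0
  · have h0' : b 0 - a 0 ≠ 0 := sub_ne_zero.2 h0.symm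
    refine ⟨(c 0 - a 0) / (b 0 - a 0), ?_⟩
    ext i
    fin_cases i <;> simp [AffineMap.lineMap_apply] <;> field_simp <;> linarith
  · have h0' : b 1 - a 1 ≠ 0 := sub_ne_zero.2 h0.symm
    refine ⟨(c 1 - a 1) / (b 1 - a 1), ?_⟩
    ext i
    fin_cases i <;> simp [AffineMap.lineMap_apply] <;> field_simp <;> linarith

theorem orient_lineMap (a b : EPlane) (r : ℝ) : orient a b (AffineMap.lineMap a b r) = 0 := by
  simp only [orient, AffineMap.lineMap_apply, vsub_eq_sub, vadd_eq_add, PiLp.add_apply,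
    PiLp.smul_apply, PiLp.sub_apply, smul_eq_mul]
  ring

/-- Convex position enters in just two ways: no point lies inside a triangle of others, as here, and
none lies between two others (`not_wbtw_of_convexIndependent`). -/
theorem not_orient_pos_of_convexIndependent {S : Finset EPlane}
    (hS : ConvexIndependent ℝ (fun v : S => (v : EPlane))) (p a b c : S)
    (h₁ : 0 < orient p a b) (h₂ : 0 < orient p b c) (h₃ : 0 < orient p c a) : False := by
  have h := mem_convexHull_of_orient_pos h₁ h₂ h₃
  have := hS {a, b, c} p (by simpa [Set.image_insert_eq] using h)
  rcases this with rfl | rfl | rfl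
  · simp [orient] at h₁
  · rw [orient_self_left] at h₁; exact h₁.ne rfl
  · rw [orient_self_left] at h₂; exact h₂.ne rfl

theorem not_wbtw_of_convexIndependent {S : Finset EPlane}
    (hS : ConvexIndependent ℝ (fun v : S => (v : EPlane))) {a b c : S}
    (hba : b ≠ a) (hbc : b ≠ c) : ¬ Wbtw ℝ (a : EPlane) b c := by
  intro h
  rw [← mem_segment_iff_wbtw, ← convexHull_pair] at h
  have := hS {a, c} b (by simpa [Set.image_insert_eq] using h)
  rcases this with rfl | rfl
  exacts [hba rfl, hbc rfl]

theorem orient_ne_zero_of_convexIndependent {S : Finset EPlane}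
    (hS : ConvexIndependent ℝ (fun v : S => (v : EPlane))) {a b c : S}
    (hab : a ≠ b) (hac : a ≠ c) (hbc : b ≠ c) : orient a b c ≠ 0 := by
  intro h
  obtain ⟨r, hr⟩ := mem_affineSpan_pair_of_orient_eq_zero
    (fun h => hab (Subtype.ext h)) h
  have hc : Collinear ℝ {(c : EPlane), (a : EPlane), (b : EPlane)} :=
    collinear_insert_of_mem_affineSpan_pair
      (hr ▸ AffineMap.lineMap_mem_affineSpan_pair r _ _)
  rcases hc.wbtw_or_wbtw_or_wbtw with h | h | h
  · exact not_wbtw_of_convexIndependent hS hac hab h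
  · exact not_wbtw_of_convexIndependent hS hab.symm hbc h
  · exact not_wbtw_of_convexIndependent hS hbc.symm hac.symm h

/-! ### Crossings as sign conditions -/

namespace PlaneEdge

variable {S : Finset EPlane}

theorem line_mk (a b : S) : line s(a, b) = affineSpan ℝ {(a : EPlane), (b : EPlane)} := by
  unfold line
  congr 1
  ext p
  simp only [Sym2.mem_iff, Set.mem_image, Set.mem_ofPred_eq, Set.mem_insert_iff,
    Set.mem_singleton_iff]
  constructor
  · rintro ⟨v, rfl | rfl, rfl⟩ <;> simp
  · rintro (rfl | rfl)
    exacts [⟨a, Or.inl rfl, rfl⟩, ⟨b, Or.inr rfl, rfl⟩]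

theorem mem_line_iff {a b : S} (hab : a ≠ b) (p : EPlane) :
    p ∈ line s(a, b) ↔ orient a b p = 0 := by
  rw [line_mk]
  constructor
  · intro h
    obtain ⟨r, rfl⟩ := mem_affineSpan_pair_iff_exists_lineMap_eq.1 h
    exact orient_lineMap _ _ _
  · intro h
    obtain ⟨r, rfl⟩ := mem_affineSpan_pair_of_orient_eq_zero (fun h => hab (Subtype.ext h)) h
    exact AffineMap.lineMap_mem_affineSpan_pair r _ _

theorem orient_mul_neg_of_mem_openSegment {a b c d p : EPlane} (hp : p ∈ openSegment ℝ c d)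
    (h : orient a b p = 0) (hc : orient a b c ≠ 0) : orient a b c * orient a b d < 0 := by
  obtain ⟨s, t, hs, ht, hst, rfl⟩ := hp
  rw [orient_combo _ _ _ _ hst] at h
  have h1 : t * (orient a b c * orient a b d) = - (s * orient a b c ^ 2) := by
    linear_combination orient a b c * h
  have h2 : 0 < s * orient a b c ^ 2 := by positivity
  by_contra! h3
  have := mul_nonneg ht.le h3
  linarith

theorem sOppSide_iff_orient {a b c d : S} (hab : a ≠ b) :
    (line s(a, b)).SOppSide (c : EPlane) (d : EPlane) ↔
      orient a b c * orient a b d < 0 := by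
  constructor
  · intro h
    obtain ⟨p, hp, hcd⟩ := h.exists_sbtw
    have hc : orient a b c ≠ 0 := fun h0 => h.2.1 ((mem_line_iff hab _).2 h0)
    have hp' : p ∈ openSegment ℝ (c : EPlane) d := by
      rw [openSegment_eq_image_lineMap]
      exact hcd.mem_image_Ioo
    exact orient_mul_neg_of_mem_openSegment hp' ((mem_line_iff hab _).1 hp) hc
  · intro h
    have hc : orient a b c ≠ 0 := fun h0 => by simp [h0] at h
    have hd : orient a b d ≠ 0 := fun h0 => by simp [h0] at h
    refine ⟨AffineSubspace.wOppSide_iff_exists_wbtw.2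
      ⟨AffineMap.lineMap (c : EPlane) (d : EPlane) (orient a b c / (orient a b c - orient a b d)), ?_, ?_⟩,
      fun h0 => hc ((mem_line_iff hab _).1 h0), fun h0 => hd ((mem_line_iff hab _).1 h0)⟩
    · have hne : orient a b c - orient a b d ≠ 0 := fun h0 => by
        rw [sub_eq_zero.1 h0] at h; nlinarith [mul_self_nonneg (orient a b d)]
      rw [mem_line_iff hab, AffineMap.lineMap_apply_module, orient_combo _ _ _ _ (by ring)]
      field_simp
      ring
    · refine ⟨_, ⟨?_, ?_⟩, rfl⟩
      all_goals
        rcases mul_neg_iff.1 h with ⟨h1, h2⟩ | ⟨h1, h2⟩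
      · exact div_nonneg h1.le (by linarith)
      · exact div_nonneg_of_nonpos h1.le (by linarith)
      · rw [div_le_one (by linarith)]; linarith
      · rw [div_le_one_of_neg (by linarith)]; linarith

theorem orient_mul_neg_of_cross (hS : ConvexIndependent ℝ (fun v : S => (v : EPlane)))
    {a b c d : S} (hab : a ≠ b) (h : Cross s(a, b) s(c, d)) :
    orient a b c * orient a b d < 0 := by
  obtain ⟨hne, p, hp, hq⟩ := h
  change p ∈ openSegment ℝ (a : EPlane) b at hp
  change p ∈ openSegment ℝ (c : EPlane) d at hq
  have hab' : (a : EPlane) ≠ b := fun h => hab (Subtype.ext h)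
  have hp0 : orient a b p = 0 := by
    obtain ⟨s, t, hs, ht, hst, rfl⟩ := hp
    rw [orient_combo _ _ _ _ hst, orient_self_left, orient_self_right]; ring
  -- A loop at `c` has open segment `{c}`, so a crossing with it would put `c` between `a` and `b`.
  have hdiag : c ≠ d := by
    rintro rfl
    rw [openSegment_same] at hq
    obtain rfl : p = c := hq
    have hw := mem_segment_iff_wbtw.1 (openSegment_subset_segment ℝ _ _ hp)
    have hca : c ≠ a := fun h => by
      rw [h] at hp
      exact hab' (left_mem_openSegment_iff.1 hp)
    have hcb : c ≠ b := fun h => by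
      rw [h] at hp
      exact hab' (right_mem_openSegment_iff.1 hp)
    exact not_wbtw_of_convexIndependent hS hca hcb hw
  have key : ∀ c d : S, c ≠ d → s(a, b) ≠ s(c, d) → p ∈ openSegment ℝ (c : EPlane) d →
      orient a b c ≠ 0 := by
    intro c d hcd hne hq hc0
    have hd0 : orient a b d = 0 := by
      obtain ⟨s, t, hs, ht, hst, rfl⟩ := hq
      rw [orient_combo _ _ _ _ hst, hc0] at hp0
      simpa [ht.ne'] using hp0
    have mem : ∀ c : S, orient a b c = 0 → c = a ∨ c = b := by
      intro c hc
      by_contra! hcc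
      exact orient_ne_zero_of_convexIndependent hS hab hcc.1.symm hcc.2.symm hc
    rcases mem c hc0 with rfl | rfl <;> rcases mem d hd0 with rfl | rfl
    · exact hcd rfl
    · exact hne rfl
    · exact hne Sym2.eq_swap
    · exact hcd rfl
  exact orient_mul_neg_of_mem_openSegment hq hp0 (key c d hdiag hne hq)

/-- If the line `ab` separates `c` and `d`, and the points are in convex position, then the
line `cd` separates `a` and `b`. -/
theorem orient_mul_neg_symm (hS : ConvexIndependent ℝ (fun v : S => (v : EPlane)))
    {a b c d : S} (h₁ : 0 < orient a b c) (h₂ : orient a b d < 0) :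
    orient c d a < 0 ∧ 0 < orient c d b := by
  have hac : a ≠ c := by rintro rfl; simp [orient_self_left] at h₁
  have hbc : b ≠ c := by rintro rfl; simp [orient_self_right] at h₁
  have had : a ≠ d := by rintro rfl; simp [orient_self_left] at h₂
  have hbd : b ≠ d := by rintro rfl; simp [orient_self_right] at h₂
  have hcd : c ≠ d := by rintro rfl; linarith
  have h3 := orient_ne_zero_of_convexIndependent hS hcd hac.symm had.symm
  have h4 := orient_ne_zero_of_convexIndependent hS hcd hbc.symm hbd.symm
  constructor
  -- With the wrong sign `a` would lie inside the triangle `b c d`; in the second half, `b` inside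
  -- `d c a`.
  · refine lt_of_le_of_ne (not_lt.1 fun h => ?_) h3
    refine not_orient_pos_of_convexIndependent hS a b c d h₁ ?_ ?_
    · rwa [← orient_rotate, ]
    · rw [orient_swap]; linarith
  · refine lt_of_le_of_ne (not_lt.1 fun h => ?_) h4.symm
    refine not_orient_pos_of_convexIndependent hS b d c a ?_ ?_ ?_
    · rw [orient_swap, orient_rotate, orient_rotate]; linarith
    · rwa [orient_rotate]
    · rw [← orient_rotate, orient_swap]
      linarith

theorem cross_of_orient (hS : ConvexIndependent ℝ (fun v : S => (v : EPlane)))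
    {a b c d : S} (h₁ : 0 < orient a b c) (h₂ : orient a b d < 0) :
    Cross s(a, b) s(c, d) := by
  obtain ⟨h3, h4⟩ := orient_mul_neg_symm hS h₁ h₂
  refine ⟨fun h => ?_, ?_⟩
  · have hc : c ∈ s(a, b) := h ▸ Sym2.mem_mk_left c d
    rcases Sym2.mem_iff.1 hc with rfl | rfl
    · simp [orient_self_left] at h₁
    · simp [orient_self_right] at h₁
  · have hX : 0 < orient a b c - orient a b d := by linarith
    have hXY : orient c d b - orient c d a = orient a b c - orient a b d := by
      unfold orient; ring
    -- The weights make `orient a b` vanish; the same point has weights in `a`, `b` that make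
    -- `orient c d` vanish.
    refine ⟨(-orient a b d / (orient a b c - orient a b d)) • (c : EPlane)
      + (orient a b c / (orient a b c - orient a b d)) • (d : EPlane), ?_, ?_⟩
    · refine ⟨orient c d b / (orient a b c - orient a b d),
        -orient c d a / (orient a b c - orient a b d), by positivity,
        div_pos (by linarith) hX, by rw [← add_div, div_eq_one_iff_eq hX.ne']; linarith, ?_⟩
      ext i
      simp only [PiLp.add_apply, PiLp.smul_apply, smul_eq_mul]
      field_simp
      fin_cases i <;> simp [orient] <;> ring
    · exact ⟨_, _, div_pos (by linarith) hX, by positivity,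
        by rw [← add_div, div_eq_one_iff_eq hX.ne']; ring, rfl⟩

theorem cross_iff_orient (hS : ConvexIndependent ℝ (fun v : S => (v : EPlane)))
    {a b c d : S} (hab : a ≠ b) :
    Cross s(a, b) s(c, d) ↔ orient a b c * orient a b d < 0 := by
  refine ⟨orient_mul_neg_of_cross hS hab, fun h => ?_⟩
  rcases mul_neg_iff.1 h with ⟨h1, h2⟩ | ⟨h1, h2⟩
  · exact cross_of_orient hS h1 h2
  · rw [Sym2.eq_swap (a := c)]
    exact cross_of_orient hS h2 h1

theorem sOppSide_iff_cross (hS : ConvexIndependent ℝ (fun v : S => (v : EPlane)))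
    {a b c d : S} (hab : a ≠ b) :
    (line s(a, b)).SOppSide (c : EPlane) (d : EPlane) ↔ Cross s(a, b) s(c, d) := by
  rw [sOppSide_iff_orient hab, cross_iff_orient hS hab]

/-- An edge on the convex hull is not crossed. -/
theorem OnHull.not_cross (hS : ConvexIndependent ℝ (fun v : S => (v : EPlane)))
    {a b u v : S} (h : OnHull s(a, b)) (hab : a ≠ b) : ¬ Cross s(a, b) s(u, v) := by
  intro hc
  have hneg := orient_mul_neg_of_cross hS hab hc
  wlog hu : 0 < orient a b u generalizing u v
  · rcases mul_neg_iff.1 hneg with ⟨h1, h2⟩ | ⟨h1, h2⟩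
    · exact hu h1
    · exact this (by rwa [Sym2.eq_swap (a := v)]) (by rwa [mul_comm]) h2
  have hv : orient a b v < 0 := by
    by_contra! h0
    exact absurd hneg (not_lt.2 (mul_nonneg hu.le h0))
  obtain ⟨h3, -⟩ := orient_mul_neg_symm hS hu hv
  obtain ⟨-, p, hp, hq⟩ := hc
  change p ∈ openSegment ℝ (a : EPlane) b at hp
  change p ∈ openSegment ℝ (u : EPlane) v at hq
  -- The midpoint of `a` and the crossing point is on the edge, but inside the open triangle `v u
  -- a`, hence not on the boundary of the hull.
  set q : EPlane := (1 / 2 : ℝ) • (a : EPlane) + (1 / 2 : ℝ) • p with hqdef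
  have hqs : q ∈ seg s(a, b) :=
    (convex_segment (a : EPlane) (b : EPlane)) (left_mem_segment ℝ _ _)
      (openSegment_subset_segment ℝ _ _ hp) (by norm_num) (by norm_num) (by norm_num)
  have hfr := h hqs
  refine hfr.2 ?_
  rw [mem_interior]
  refine ⟨{q | 0 < orient v u q ∧ 0 < orient u a q ∧ 0 < orient a v q}, ?_, ?_, ?_⟩
  · rintro r ⟨h1, h2, h4⟩
    have := mem_convexHull_of_orient_pos (p := r) (a := v) (b := u) (c := a)
      (by rwa [← orient_rotate]) (by rwa [← orient_rotate]) (by rwa [← orient_rotate])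
    refine convexHull_mono ?_ this
    rintro _ (rfl | rfl | rfl) <;> simp
  · exact ((isOpen_lt continuous_const (orient_continuous _ _)).inter
      ((isOpen_lt continuous_const (orient_continuous _ _)).inter
        (isOpen_lt continuous_const (orient_continuous _ _))))
  · obtain ⟨s, t, hs, ht, hst, rfl⟩ := hq
    have h5 : 0 < orient v u a := by
      have : orient v u a = - orient u v a := by unfold orient; ring
      linarith
    have e1 : orient v u a = orient u a v := by unfold orient; ring
    have e2 : orient v u a = orient a v u := by unfold orient; ring
    simp only [Set.mem_ofPred_eq, hqdef]
    have half : (1 / 2 : ℝ) + 1 / 2 = 1 := by norm_num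
    simp only [orient_combo _ _ _ _ half, orient_combo _ _ _ _ hst]
    simp only [orient_self_left, orient_self_right]
    rw [← e1, ← e2]
    refine ⟨by linarith, ?_, ?_⟩ <;> ring_nf <;> positivity

end PlaneEdge

/-! ### Angular order -/

/-- The chords `a b` and `c d` of a set of numbers interleave. -/
def Interleave (a b c d : ℕ) : Prop :=
  (min a b < min c d ∧ min c d < max a b ∧ max a b < max c d) ∨
    (min c d < min a b ∧ min a b < max c d ∧ max c d < max a b)

namespace PlaneEdge

variable {S : Finset EPlane}

theorem Cross.symm {e f : Sym2 S} (h : Cross e f) : Cross f e :=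
  ⟨h.1.symm, by rw [Set.inter_comm]; exact h.2⟩

/-- Points in convex position, listed in their angular order around one of them, cross like the
chords of a circle. -/
theorem exists_angular_order (hS : ConvexIndependent ℝ (fun v : S => (v : EPlane))) (x : S) :
    ∃ pos : S → ℕ, Function.Injective pos ∧ pos x = 0 ∧
      ∀ a b c d, a ≠ b →
        (Cross s(a, b) s(c, d) ↔ Interleave (pos a) (pos b) (pos c) (pos d)) := by
  classical
  -- `x` comes first, then the other points counterclockwise as seen from `x`. If transitivity
  -- failed, `x` would lie inside the triangle `a b c`.
  let r : S → S → Prop := fun a b => b ≠ x ∧ (a = x ∨ 0 < orient x a b)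
  have ne_of_orient : ∀ {a b c : S}, 0 < orient a b c → a ≠ b ∧ a ≠ c ∧ b ≠ c := by
    intro a b c h
    refine ⟨?_, ?_, ?_⟩ <;> rintro rfl <;> simp [orient, mul_comm] at h
  have irrefl : ∀ a, ¬ r a a := by
    rintro a ⟨h1, h2 | h2⟩
    · exact h1 h2
    · exact (ne_of_orient h2).2.2 rfl
  have otrans : ∀ a b c : S, 0 < orient x a b → 0 < orient x b c → 0 < orient x a c := by
    intro a b c h1 h2
    have hac : a ≠ c := by
      rintro rfl
      rw [orient_swap] at h2
      linarith
    have h0 := orient_ne_zero_of_convexIndependent hS (ne_of_orient h1).1 (ne_of_orient h2).2.1 hac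
    refine lt_of_le_of_ne (not_lt.1 fun h => ?_) h0.symm
    exact not_orient_pos_of_convexIndependent hS x a b c h1 h2 (by rw [orient_swap]; linarith)
  have trans : ∀ a b c, r a b → r b c → r a c := by
    rintro a b c ⟨h1, h2⟩ ⟨h3, h4⟩
    refine ⟨h3, ?_⟩
    rcases h2 with h2 | h2
    · exact Or.inl h2
    · exact Or.inr (otrans a b c h2 (h4.resolve_left h1))
  have total : ∀ a b, a ≠ b → r a b ∨ r b a := by
    intro a b hab
    by_cases ha : a = x
    · exact Or.inl ⟨fun h => hab (ha.trans h.symm), Or.inl ha⟩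
    by_cases hb : b = x
    · exact Or.inr ⟨ha, Or.inl hb⟩
    rcases lt_or_gt_of_ne (orient_ne_zero_of_convexIndependent hS (Ne.symm ha) (Ne.symm hb) hab)
      with h | h
    · exact Or.inr ⟨ha, Or.inr (by rw [orient_swap]; linarith)⟩
    · exact Or.inl ⟨hb, Or.inr h⟩
  let pos : S → ℕ := fun a => (Finset.univ.filter fun b => r b a).card
  have pos_lt : ∀ {a b}, r a b → pos a < pos b := by
    intro a b h
    refine Finset.card_lt_card (Finset.ssubset_iff_of_subset ?_ |>.2 ⟨a, ?_, ?_⟩)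
    · intro c hc
      simp only [Finset.mem_filter, Finset.mem_univ, true_and] at hc ⊢
      exact trans c a b hc h
    · simpa using h
    · simpa using irrefl a
  have inj : Function.Injective pos := by
    intro a b h
    by_contra hab
    rcases total a b hab with h' | h'
    · exact (pos_lt h').ne h
    · exact (pos_lt h').ne' h
  -- Increasing triples are counterclockwise: otherwise `b` would lie inside the triangle `x a c`.
  have ccw : ∀ {a b c : S}, r a b → r b c → 0 < orient a b c := by
    intro a b c hab hbc
    have hbx := hab.1
    have h2 := hbc.2.resolve_left hbx
    rcases hab.2 with rfl | h1
    · exact h2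
    have h3 := otrans a b c h1 h2
    have hac := (trans a b c hab hbc)
    have h0 := orient_ne_zero_of_convexIndependent hS (ne_of_orient h1).2.2
      (ne_of_orient h3).2.2 (ne_of_orient h2).2.2
    refine lt_of_le_of_ne (not_lt.1 fun h => ?_) h0.symm
    refine not_orient_pos_of_convexIndependent hS b x a c ?_ ?_ ?_
    · rwa [orient_rotate, orient_rotate]
    · rw [orient_swap, orient_rotate]
      linarith
    · rwa [orient_rotate]
  have hpos : ∀ {a b c : S}, r a b → (0 < orient a b c ↔ pos c < pos a ∨ pos b < pos c) ∧
      (orient a b c < 0 ↔ pos a < pos c ∧ pos c < pos b) := by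
    intro a b c hab
    have hlt := pos_lt hab
    by_cases hca : c = a
    · subst hca; simp [orient_self_left]; omega
    by_cases hcb : c = b
    · subst hcb; simp [orient_self_right]; omega
    rcases total c a hca with h | h
    · have h1 := ccw h hab
      rw [← orient_rotate] at h1
      have := pos_lt h
      constructor <;> constructor <;> intro <;> first | linarith | omega
    rcases total c b hcb with h' | h'
    · have h1 := ccw h h'
      rw [orient_swap] at h1
      have := pos_lt h
      have := pos_lt h'
      constructor <;> constructor <;> intro <;> first | linarith | omega
    · have h1 := ccw hab h'
      have := pos_lt h
      have := pos_lt h'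
      constructor <;> constructor <;> intro <;> first | linarith | omega
  refine ⟨pos, inj, ?_, ?_⟩
  · rw [Finset.card_eq_zero, Finset.filter_eq_empty_iff]
    intro b _ hb
    exact hb.1 rfl
  · intro a b c d hab
    wlog h : r a b generalizing a b
    · rw [Sym2.eq_swap, this b a hab.symm ((total a b hab).resolve_left h)]
      unfold Interleave
      omega
    rw [cross_iff_orient hS hab, mul_neg_iff, (hpos h).1, (hpos h).1, (hpos h).2, (hpos h).2]
    have := pos_lt h
    unfold Interleave
    omega

end PlaneEdge

/-! ### Parity and alternation in the union -/

namespace OddMatching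

variable {S : Finset EPlane}

theorem ne_of_mem (M : OddMatching S) {v w : S} (h : s(v, w) ∈ M.edges) : v ≠ w := by
  rintro rfl
  exact M.not_isDiag _ h (Sym2.mk_isDiag_iff.2 rfl)

theorem exists_mem_edges (M : OddMatching S) {v : S} (h : v ≠ M.isolated) :
    ∃ w, s(v, w) ∈ M.edges := by
  by_contra! hc
  refine h (M.eq_isolated fun e he hv => ?_)
  obtain ⟨w, rfl⟩ := hv
  exact hc w he

theorem eq_of_mem (M : OddMatching S) {v w w' : S} (h : s(v, w) ∈ M.edges)
    (h' : s(v, w') ∈ M.edges) : w = w' :=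
  Sym2.congr_right.1
    (M.eq_of_common_endpoint _ h _ h' v (Sym2.mem_mk_left _ _) (Sym2.mem_mk_left _ _))

theorem unionGraph_adj {M M' : OddMatching S} {v w : S} :
    (unionGraph M M').Adj v w ↔ s(v, w) ∈ M.edges ∪ M'.edges := by
  rw [unionGraph, SimpleGraph.fromEdgeSet_adj]
  exact ⟨fun h => h.1, fun h => ⟨h, h.elim M.ne_of_mem M'.ne_of_mem⟩⟩

theorem unionGraph_edgeSet (M M' : OddMatching S) :
    (unionGraph M M').edgeSet = M.edges ∪ M'.edges := by
  ext e
  induction e with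
  | _ v w => rw [SimpleGraph.mem_edgeSet, unionGraph_adj]

theorem mem_union_of_mem_walk_edges {M M' : OddMatching S} {v w : S}
    (p : (unionGraph M M').Walk v w) {e : Sym2 S} (he : e ∈ p.edges) :
    e ∈ M.edges ∪ M'.edges := by
  rw [← unionGraph_edgeSet]
  exact p.edges_subset_edgeSet he

/-- A set of points that a matching pairs up is even. -/
theorem even_card_of_closed (M : OddMatching S) (T : Finset S) (hx : M.isolated ∉ T)
    (hT : ∀ v w, s(v, w) ∈ M.edges → v ∈ T → w ∈ T) : Even T.card := by
  classical
  have hne : ∀ v ∈ T, ∃ w, s(v, w) ∈ M.edges := fun v hv =>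
    M.exists_mem_edges (fun h => hx (h ▸ hv))
  choose g hg using hne
  have h0 : ∑ _v ∈ T, (1 : ZMod 2) = 0 := by
    refine Finset.sum_involution g (fun v hv => by decide)
      (fun v hv _ h => M.ne_of_mem (hg v hv) h.symm) (fun v hv => hT _ _ (hg v hv) hv) ?_
    intro v hv
    refine M.eq_of_mem (hg _ _) ?_
    rw [Sym2.eq_swap]
    exact hg v hv
  rw [Finset.sum_const, nsmul_one] at h0
  exact (ZMod.natCast_eq_zero_iff_even).1 h0

theorem odd_card_of_closed (M : OddMatching S) (T : Finset S) (hx : M.isolated ∈ T)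
    (hT : ∀ v w, s(v, w) ∈ M.edges → v ∈ T → w ∈ T) : Odd T.card := by
  classical
  have h := M.even_card_of_closed (T.erase M.isolated) (by simp) (by
    intro v w hvw hv
    rw [Finset.mem_erase] at hv ⊢
    refine ⟨?_, hT v w hvw hv.2⟩
    rintro rfl
    exact M.isolated_notMem _ hvw (Sym2.mem_mk_right _ _))
  rw [Finset.card_erase_of_mem hx] at h
  have := Finset.card_pos.2 ⟨_, hx⟩
  rw [← Nat.not_even_iff_odd]
  intro h'
  obtain ⟨a, ha⟩ := h
  obtain ⟨b, hb⟩ := h'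
  omega

/-- The component of the isolated point of `M` is odd, because `M` pairs up the rest of it. If it
missed the isolated point of `M'`, then `M'` would pair it up completely. -/
theorem reachable_isolated (M M' : OddMatching S) :
    (unionGraph M M').Reachable M.isolated M'.isolated := by
  classical
  set T : Finset S := Finset.univ.filter fun v => (unionGraph M M').Reachable M.isolated v with hTd
  have hcl : ∀ v w, s(v, w) ∈ M.edges ∪ M'.edges → v ∈ T → w ∈ T := by
    intro v w hvw hv
    simp only [hTd, Finset.mem_filter, Finset.mem_univ, true_and] at hv ⊢
    exact hv.trans (unionGraph_adj.2 hvw).reachable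
  have hodd := M.odd_card_of_closed T (by simp [hTd]) (fun v w h => hcl v w (Or.inl h))
  by_contra hc
  have heven := M'.even_card_of_closed T (by simpa [hTd] using hc) (fun v w h => hcl v w (Or.inr h))
  exact Nat.not_even_iff_odd.2 hodd heven

/-- Away from the isolated points, an unhappy edge of `M` is not a bridge of `M ∪ M'`. -/
theorem reachable_deleteEdges {M M' : OddMatching S} {y z : S} (h : s(y, z) ∈ M.edges)
    (h' : s(y, z) ∉ M'.edges) (hx : ¬ (unionGraph M M').Reachable M.isolated y) :
    ((unionGraph M M').deleteEdges {s(y, z)}).Reachable y z := by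
  classical
  by_contra hc
  set H := (unionGraph M M').deleteEdges {s(y, z)} with hH
  have hle : H ≤ unionGraph M M' := SimpleGraph.deleteEdges_le _
  have hadj : ∀ v w, s(v, w) ∈ M.edges ∪ M'.edges → s(v, w) ≠ s(y, z) → H.Adj v w := by
    intro v w hvw hne
    rw [hH, SimpleGraph.deleteEdges_adj]
    exact ⟨unionGraph_adj.2 hvw, hne⟩
  set T : Finset S := Finset.univ.filter fun v => H.Reachable y v with hTd
  have memT : ∀ v, v ∈ T ↔ H.Reachable y v := by simp [hTd]
  -- If `y z` were a bridge, `M'` would pair up the component `T` of `y` left by its deletion, while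
  -- `M` would pair up `T` without `y`.
  have heven := M'.even_card_of_closed T
    (fun hm => hx ((reachable_isolated M M').trans (((memT _).1 hm).mono hle).symm)) (by
      intro v w hvw hv
      rw [memT] at hv ⊢
      exact hv.trans (hadj v w (Or.inr hvw) (fun he => h' (he ▸ hvw))).reachable)
  have heven' := M.even_card_of_closed (T.erase y)
    (fun hm => hx (((memT _).1 (Finset.mem_of_mem_erase hm)).mono hle).symm) (by
      intro v w hvw hv
      rw [Finset.mem_erase, memT] at hv ⊢
      have hne : s(v, w) ≠ s(y, z) := by
        intro he
        rcases Sym2.eq_iff.1 he with ⟨rfl, rfl⟩ | ⟨rfl, rfl⟩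
        · exact hv.1 rfl
        · exact hc hv.2
      refine ⟨?_, hv.2.trans (hadj v w (Or.inl hvw) hne).reachable⟩
      rintro rfl
      rw [Sym2.eq_swap] at hvw
      exact hne (by rw [M.eq_of_mem hvw h, Sym2.eq_swap]))
  have hyT : y ∈ T := (memT y).2 SimpleGraph.Reachable.rfl
  rw [Finset.card_erase_of_mem hyT] at heven'
  have := Finset.card_pos.2 ⟨_, hyT⟩
  obtain ⟨a, ha⟩ := heven
  obtain ⟨b, hb⟩ := heven'
  omega

/-- Consecutive edges of a trail are distinct and share a vertex, so no matching contains both.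
Alternation is therefore automatic for cycles and paths. -/
theorem alternates_of_isTrail {M M' : OddMatching S} {v w : S}
    {p : (unionGraph M M').Walk v w} (hp : p.IsTrail) : Alternates M M' p.edges := by
  unfold Alternates
  induction p with
  | nil => simp
  | @cons u v w h q ih =>
    have ihq := ih hp.of_cons
    cases q with
    | nil => simp
    | @cons _ t _ h' q' =>
      simp only [SimpleGraph.Walk.edges_cons, List.isChain_cons_cons] at ihq ⊢
      refine ⟨?_, ihq⟩
      have hne : s(u, v) ≠ s(v, t) := by
        have := (SimpleGraph.Walk.isTrail_cons _ _).1 hp |>.2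
        intro he
        exact this (by simp [he])
      have h1 := unionGraph_adj.1 h
      have h2 := unionGraph_adj.1 h'
      have hM : ∀ N : OddMatching S, s(u, v) ∈ N.edges → s(v, t) ∉ N.edges := fun N ha hb =>
        hne (N.eq_of_common_endpoint _ ha _ hb v (Sym2.mem_mk_right _ _) (Sym2.mem_mk_left _ _))
      have hM1 := hM M
      have hM2 := hM M'
      simp only [Set.mem_union, Set.mem_sdiff] at h1 h2 ⊢
      tauto

end OddMatching

/-! ### Edges of a walk at a vertex -/

namespace SimpleGraph.Walk

variable {V : Type*} {G : SimpleGraph V}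

theorem exists_mem_edges_start {u v : V} (p : G.Walk u v) (h : u ≠ v) :
    ∃ e ∈ p.edges, u ∈ e := by
  cases p with
  | nil => exact absurd rfl h
  | @cons _ w _ h q => exact ⟨s(u, w), by simp, Sym2.mem_mk_left _ _⟩

theorem exists_mem_edges_end {u v : V} (p : G.Walk u v) (h : u ≠ v) :
    ∃ e ∈ p.edges, v ∈ e := by
  obtain ⟨e, he, hv⟩ := p.reverse.exists_mem_edges_start h.symm
  exact ⟨e, by simpa using he, hv⟩

theorem IsTrail.exists_two_edges {u v t : V} {p : G.Walk u v} (hp : p.IsTrail)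
    (ht : t ∈ p.support) (hu : t ≠ u) (hv : t ≠ v) :
    ∃ e ∈ p.edges, ∃ f ∈ p.edges, e ≠ f ∧ t ∈ e ∧ t ∈ f := by
  induction p with
  | nil => simp at ht; exact absurd ht hu
  | @cons a b c h q ih =>
    by_cases hb : t = b
    · subst hb
      obtain ⟨f, hf, htf⟩ := q.exists_mem_edges_start hv
      refine ⟨s(a, t), by simp, f, by simp [hf], ?_, Sym2.mem_mk_right _ _, htf⟩
      rintro rfl
      exact ((isTrail_cons _ _).1 hp).2 hf
    · obtain ⟨e, he, f, hf, h'⟩ := ih hp.of_cons (by simpa [hu] using ht) hb hv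
      exact ⟨e, by simp [he], f, by simp [hf], h'⟩

theorem IsCycle.exists_two_edges {u t : V} {p : G.Walk u u} (hp : p.IsCycle)
    (ht : t ∈ p.support) : ∃ e ∈ p.edges, ∃ f ∈ p.edges, e ≠ f ∧ t ∈ e ∧ t ∈ f := by
  by_cases htu : t = u
  · subst htu
    cases p with
    | nil => exact absurd hp (by simp)
    | @cons _ b _ h q =>
      obtain ⟨hq, hn⟩ := (cons_isCycle_iff _ _).1 hp
      obtain ⟨f, hf, htf⟩ := q.exists_mem_edges_end h.ne'
      exact ⟨s(t, b), by simp, f, by simp [hf], fun he => hn (he ▸ hf), Sym2.mem_mk_left _ _, htf⟩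
  · exact hp.isTrail.exists_two_edges ht htu htu

theorem reachable_start_of_mem_support {u v t : V} (p : G.Walk u v) (ht : t ∈ p.support) :
    G.Reachable u t := by
  classical exact (p.takeUntil t ht).reachable

/-- A walk whose edges include all edges at its vertices covers a connected component. -/
theorem mem_support_of_reachable {u v t w : V} {p : G.Walk u v}
    (hp : ∀ a b, a ∈ p.support → G.Adj a b → s(a, b) ∈ p.edges) (ht : t ∈ p.support)
    (h : G.Reachable t w) : w ∈ p.support := by
  obtain ⟨q⟩ := h
  induction q with
  | nil => exact ht
  | cons h q ih => exact ih (p.snd_mem_support_of_mem_edges (hp _ _ ht h))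

end SimpleGraph.Walk

/-! ### Components: path, cycles, happy edges -/

namespace OddMatching

variable {S : Finset EPlane}

/-- Two edges of `M ∪ M'` at a vertex leave room for no third one. -/
theorem eq_or_eq_of_mem_union {M M' : OddMatching S} {e f g : Sym2 S} {v : S}
    (he : e ∈ M.edges ∪ M'.edges) (hf : f ∈ M.edges ∪ M'.edges) (hg : g ∈ M.edges ∪ M'.edges)
    (hve : v ∈ e) (hvf : v ∈ f) (hvg : v ∈ g) (hef : e ≠ f) : g = e ∨ g = f := by
  have h1 := fun a ha b hb => M.eq_of_common_endpoint a ha b hb v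
  have h2 := fun a ha b hb => M'.eq_of_common_endpoint a ha b hb v
  rcases he with he | he <;> rcases hf with hf | hf
  · exact absurd (h1 _ he _ hf hve hvf) hef
  · rcases hg with hg | hg
    · exact Or.inl (h1 _ hg _ he hvg hve)
    · exact Or.inr (h2 _ hg _ hf hvg hvf)
  · rcases hg with hg | hg
    · exact Or.inr (h1 _ hg _ hf hvg hvf)
    · exact Or.inl (h2 _ hg _ he hvg hve)
  · exact absurd (h2 _ he _ hf hve hvf) hef

theorem eq_of_mem_happy {M M' : OddMatching S} {e g : Sym2 S} {v : S}
    (he : e ∈ happy M M') (hg : g ∈ M.edges ∪ M'.edges) (hve : v ∈ e) (hvg : v ∈ g) : g = e :=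
  hg.elim (fun h => M.eq_of_common_endpoint _ h _ he.1 v hvg hve)
    (fun h => M'.eq_of_common_endpoint _ h _ he.2 v hvg hve)

theorem mem_of_reachable_happy {M M' : OddMatching S} {a b v w : S}
    (h : s(a, b) ∈ happy M M') (hv : v ∈ s(a, b)) (hvw : (unionGraph M M').Reachable v w) :
    w ∈ s(a, b) := by
  obtain ⟨p⟩ := hvw
  induction p with
  | nil => exact hv
  | cons h' q ih =>
    refine ih ?_
    rw [← eq_of_mem_happy h (unionGraph_adj.1 h') hv (Sym2.mem_mk_left _ _)]
    exact Sym2.mem_mk_right _ _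

theorem not_reachable_happy {M M' : OddMatching S} {a b v : S}
    (h : s(a, b) ∈ happy M M') (hv : v ∈ s(a, b)) :
    ¬ (unionGraph M M').Reachable v M.isolated := fun h' =>
  M.isolated_notMem _ h.1 (mem_of_reachable_happy h hv h')

/-- The edges of `M ∪ M'` in a connected component. -/
def componentEdges (M M' : OddMatching S) (K : (unionGraph M M').ConnectedComponent) :
    Set (Sym2 S) :=
  {e | e ∈ M.edges ∪ M'.edges ∧ ∃ v ∈ e, (unionGraph M M').connectedComponentMk v = K}

theorem componentEdges_unique {M M' : OddMatching S} {K L : (unionGraph M M').ConnectedComponent}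
    {e : Sym2 S} (hK : e ∈ componentEdges M M' K) (hL : e ∈ componentEdges M M' L) : K = L := by
  obtain ⟨he, v, hv, rfl⟩ := hK
  obtain ⟨-, w, hw, rfl⟩ := hL
  obtain ⟨a, rfl⟩ := hv
  rcases Sym2.mem_iff.1 hw with rfl | rfl
  · rfl
  · exact SimpleGraph.ConnectedComponent.sound (unionGraph_adj.2 he).reachable

theorem componentEdges_happy {M M' : OddMatching S} {a b : S} (h : s(a, b) ∈ happy M M') :
    componentEdges M M' ((unionGraph M M').connectedComponentMk a) = {s(a, b)} := by
  ext e
  constructor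
  · rintro ⟨he, v, hv, hva⟩
    exact eq_of_mem_happy h he (mem_of_reachable_happy h (Sym2.mem_mk_left _ _)
      (SimpleGraph.ConnectedComponent.exact hva).symm) hv
  · rintro rfl
    exact ⟨Or.inl h.1, a, Sym2.mem_mk_left _ _, rfl⟩

theorem componentEdges_eq_of_closed {M M' : OddMatching S} {u v : S}
    {p : (unionGraph M M').Walk u v}
    (hp : ∀ t ∈ p.support, ∀ g ∈ M.edges ∪ M'.edges, t ∈ g → g ∈ p.edges) :
    componentEdges M M' ((unionGraph M M').connectedComponentMk u) = {e | e ∈ p.edges} := by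
  ext e
  constructor
  · rintro ⟨he, t, ht, htu⟩
    refine hp t ?_ e he ht
    exact SimpleGraph.Walk.mem_support_of_reachable (fun a b ha hab => hp a ha _
      (unionGraph_adj.1 hab) (Sym2.mem_mk_left _ _)) p.start_mem_support
      (SimpleGraph.ConnectedComponent.exact htu).symm
  · intro he
    refine ⟨mem_union_of_mem_walk_edges p he, ?_⟩
    induction e with
    | _ a b =>
      exact ⟨a, Sym2.mem_mk_left _ _, SimpleGraph.ConnectedComponent.sound
        (p.reachable_start_of_mem_support (p.fst_mem_support_of_mem_edges he)).symm⟩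

theorem mem_edges_of_isCycle {M M' : OddMatching S} {u : S} {p : (unionGraph M M').Walk u u}
    (hp : p.IsCycle) {t : S} (ht : t ∈ p.support) {g : Sym2 S} (hg : g ∈ M.edges ∪ M'.edges)
    (htg : t ∈ g) : g ∈ p.edges := by
  obtain ⟨e, he, f, hf, hne, hte, htf⟩ := hp.exists_two_edges ht
  rcases eq_or_eq_of_mem_union (mem_union_of_mem_walk_edges p he)
    (mem_union_of_mem_walk_edges p hf) hg hte htf htg hne with rfl | rfl
  exacts [he, hf]

theorem isolated_notMem_support_of_isCycle {M M' : OddMatching S} {u : S}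
    {p : (unionGraph M M').Walk u u} (hp : p.IsCycle) : M.isolated ∉ p.support := by
  intro ht
  obtain ⟨e, he, f, hf, hne, hte, htf⟩ := hp.exists_two_edges ht
  have hM' : ∀ e ∈ p.edges, M.isolated ∈ e → e ∈ M'.edges := fun e he hte =>
    (mem_union_of_mem_walk_edges p he).resolve_left fun h => M.isolated_notMem _ h hte
  exact hne (M'.eq_of_common_endpoint _ (hM' e he hte) _ (hM' f hf htf) _ hte htf)

theorem notMem_happy_of_isCycle {M M' : OddMatching S} {u : S} {p : (unionGraph M M').Walk u u}
    (hp : p.IsCycle) {g : Sym2 S} (hg : g ∈ p.edges) : g ∉ happy M M' := by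
  intro hh
  induction g with
  | _ a b =>
    obtain ⟨e, he, f, hf, hne, hte, htf⟩ := hp.exists_two_edges (p.fst_mem_support_of_mem_edges hg)
    have h1 := eq_of_mem_happy hh (mem_union_of_mem_walk_edges p he) (Sym2.mem_mk_left _ _) hte
    have h2 := eq_of_mem_happy hh (mem_union_of_mem_walk_edges p hf) (Sym2.mem_mk_left _ _) htf
    exact hne (h1.trans h2.symm)

/-- A cycle contains all edges of the union at its vertices and avoids the isolated point, so `M`
pairs up its vertices. Evenness, too, is automatic. -/
theorem even_length_of_isCycle {M M' : OddMatching S} {u : S} {p : (unionGraph M M').Walk u u}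
    (hp : p.IsCycle) : Even p.length := by
  classical
  -- Dropping the head of the support removes the repetition of the start vertex, which leaves
  -- `p.length` distinct vertices.
  have hmem : ∀ v, v ∈ p.support.tail.toFinset ↔ v ∈ p.support := by
    intro v
    rw [List.mem_toFinset]
    refine ⟨List.mem_of_mem_tail, fun h => ?_⟩
    rw [SimpleGraph.Walk.mem_support_iff] at h
    rcases h with rfl | h
    · exact SimpleGraph.Walk.end_mem_tail_support hp.not_nil
    · exact h
  have h := M.even_card_of_closed p.support.tail.toFinset
    (by rw [hmem]; exact isolated_notMem_support_of_isCycle hp) (by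
      intro v w hvw hv
      rw [hmem] at hv ⊢
      exact p.snd_mem_support_of_mem_edges
        (mem_edges_of_isCycle hp hv (Or.inl hvw) (Sym2.mem_mk_left _ _)))
  rw [List.toFinset_card_of_nodup hp.support_nodup] at h
  simpa using h

theorem altCycles_eq (M M' : OddMatching S) :
    altCycles M M' = {Z | ∃ (v : S) (p : (unionGraph M M').Walk v v), p.IsCycle ∧
      Z = {e | e ∈ p.edges}} := by
  ext Z
  constructor
  · rintro ⟨v, p, hp, -, -, hZ⟩
    exact ⟨v, p, hp, hZ⟩
  · rintro ⟨v, p, hp, hZ⟩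
    exact ⟨v, p, hp, even_length_of_isCycle hp, alternates_of_isTrail hp.isTrail, hZ⟩

theorem exists_component_of_mem_altCycles {M M' : OddMatching S} {Z : Set (Sym2 S)}
    (hZ : Z ∈ altCycles M M') :
    (∃ K, K ≠ (unionGraph M M').connectedComponentMk M.isolated ∧
      componentEdges M M' K = Z) ∧ ∀ e ∈ Z, e ∉ happy M M' := by
  rw [altCycles_eq] at hZ
  obtain ⟨v, p, hp, rfl⟩ := hZ
  have hcl : ∀ t ∈ p.support, ∀ g ∈ M.edges ∪ M'.edges, t ∈ g → g ∈ p.edges :=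
    fun t ht g hg htg => mem_edges_of_isCycle hp ht hg htg
  refine ⟨⟨_, fun h => ?_, componentEdges_eq_of_closed hcl⟩,
    fun e he => notMem_happy_of_isCycle hp he⟩
  exact isolated_notMem_support_of_isCycle hp
    (SimpleGraph.Walk.mem_support_of_reachable (fun a b ha hab => hcl a ha _
      (unionGraph_adj.1 hab) (Sym2.mem_mk_left _ _)) p.start_mem_support
      (SimpleGraph.ConnectedComponent.exact h))

/-- The edge is not a bridge, hence lies on a cycle, and a cycle exhausts its component. -/
theorem componentEdges_mem_altCycles {M M' : OddMatching S} {a b : S} (h : s(a, b) ∈ M.edges)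
    (h' : s(a, b) ∉ M'.edges) (hx : ¬ (unionGraph M M').Reachable M.isolated a) :
    componentEdges M M' ((unionGraph M M').connectedComponentMk a) ∈ altCycles M M' := by
  obtain ⟨u, p, hp, hab⟩ := SimpleGraph.adj_and_reachable_delete_edges_iff_exists_cycle.1
    ⟨unionGraph_adj.2 (Or.inl h), reachable_deleteEdges h h' hx⟩
  have hcl : ∀ t ∈ p.support, ∀ g ∈ M.edges ∪ M'.edges, t ∈ g → g ∈ p.edges :=
    fun t ht g hg htg => mem_edges_of_isCycle hp ht hg htg
  rw [altCycles_eq]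
  refine ⟨u, p, hp, ?_⟩
  rw [← componentEdges_eq_of_closed hcl]
  congr 1
  exact SimpleGraph.ConnectedComponent.sound
    (p.reachable_start_of_mem_support (p.fst_mem_support_of_mem_edges hab)).symm

/-- At an inner vertex the path already uses two edges. At an end only one matching has an edge, and
the path uses it. -/
theorem mem_edges_of_isPath {M M' : OddMatching S}
    {p : (unionGraph M M').Walk M.isolated M'.isolated} (hp : p.IsPath) :
    ∀ t ∈ p.support, ∀ g ∈ M.edges ∪ M'.edges, t ∈ g → g ∈ p.edges := by
  intro t ht g hg htg
  by_cases h1 : t = M.isolated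
  · have hgM : g ∈ M'.edges := hg.resolve_left fun h => M.isolated_notMem _ h (h1 ▸ htg)
    have hne : M.isolated ≠ M'.isolated := fun h => M'.isolated_notMem _ hgM (h ▸ h1 ▸ htg)
    obtain ⟨e, he, hxe⟩ := p.exists_mem_edges_start hne
    have heM : e ∈ M'.edges := (mem_union_of_mem_walk_edges p he).resolve_left
      fun h => M.isolated_notMem _ h hxe
    rwa [M'.eq_of_common_endpoint _ hgM _ heM t htg (h1 ▸ hxe)]
  by_cases h2 : t = M'.isolated
  · have hgM : g ∈ M.edges := hg.resolve_right fun h => M'.isolated_notMem _ h (h2 ▸ htg)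
    have hne : M.isolated ≠ M'.isolated := fun h => M.isolated_notMem _ hgM (h ▸ h2 ▸ htg)
    obtain ⟨e, he, hxe⟩ := p.exists_mem_edges_end hne
    have heM : e ∈ M.edges := (mem_union_of_mem_walk_edges p he).resolve_right
      fun h => M'.isolated_notMem _ h hxe
    rwa [M.eq_of_common_endpoint _ hgM _ heM t htg (h2 ▸ hxe)]
  obtain ⟨e, he, f, hf, hne, hte, htf⟩ := hp.isTrail.exists_two_edges ht h1 h2
  rcases eq_or_eq_of_mem_union (mem_union_of_mem_walk_edges p he)
    (mem_union_of_mem_walk_edges p hf) hg hte htf htg hne with rfl | rfl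
  exacts [he, hf]

theorem pathEdges_eq (M M' : OddMatching S) :
    pathEdges M M' = M.edges ∩
      componentEdges M M' ((unionGraph M M').connectedComponentMk M.isolated) := by
  ext e
  constructor
  · rintro ⟨he, p, hp, -, hep⟩
    refine ⟨he, ?_⟩
    rw [componentEdges_eq_of_closed (mem_edges_of_isPath hp)]
    exact hep
  · rintro ⟨he, hK⟩
    obtain ⟨p, hp⟩ := (reachable_isolated M M').exists_isPath
    rw [componentEdges_eq_of_closed (mem_edges_of_isPath hp)] at hK
    exact ⟨he, p, hp, alternates_of_isTrail hp.isTrail, hK⟩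

theorem cycleEdges_union_pathEdges (M M' : OddMatching S) :
    cycleEdges M M' ∪ pathEdges M M' = M.edges \ M'.edges := by
  rw [pathEdges_eq]
  ext e
  constructor
  · rintro (⟨he, Z, hZ, heZ⟩ | ⟨he, hK⟩)
    · exact ⟨he, fun h => (exists_component_of_mem_altCycles hZ).2 e heZ ⟨he, h⟩⟩
    · refine ⟨he, fun h => ?_⟩
      obtain ⟨-, v, hv, hvx⟩ := hK
      obtain ⟨w, rfl⟩ := hv
      exact not_reachable_happy ⟨he, h⟩ (Sym2.mem_mk_left _ _)
        (SimpleGraph.ConnectedComponent.exact hvx)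
  · rintro ⟨he, h'⟩
    induction e with
    | _ a b =>
      by_cases hx : (unionGraph M M').Reachable M.isolated a
      · exact Or.inr ⟨he, Or.inl he, a, Sym2.mem_mk_left _ _,
          SimpleGraph.ConnectedComponent.sound hx.symm⟩
      · exact Or.inl ⟨he, _, componentEdges_mem_altCycles he h' hx, Or.inl he, a,
          Sym2.mem_mk_left _ _, rfl⟩

theorem disjoint_cycleEdges_pathEdges (M M' : OddMatching S) :
    Disjoint (cycleEdges M M') (pathEdges M M') := by
  rw [pathEdges_eq, Set.disjoint_left]
  rintro e ⟨-, Z, hZ, heZ⟩ ⟨-, hK⟩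
  obtain ⟨⟨K, hK', rfl⟩, -⟩ := exists_component_of_mem_altCycles hZ
  exact hK' (componentEdges_unique heZ hK)

theorem ncard_cycleEdges_add_ncard_pathEdges (M M' : OddMatching S) :
    (cycleEdges M M').ncard + (pathEdges M M').ncard + (happy M M').ncard = M.edges.ncard := by
  rw [← Set.ncard_union_eq (disjoint_cycleEdges_pathEdges M M') (Set.toFinite _) (Set.toFinite _),
    cycleEdges_union_pathEdges, happy, add_comm,
    Set.ncard_inter_add_ncard_sdiff_eq_ncard _ _ (Set.toFinite _)]

/-- The number of connected components of `M ∪ M'`. -/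
noncomputable def numComponents (M M' : OddMatching S) : ℕ :=
  Nat.card (unionGraph M M').ConnectedComponent

theorem componentEdges_nonempty {M M' : OddMatching S} {K : (unionGraph M M').ConnectedComponent}
    (hK : K ≠ (unionGraph M M').connectedComponentMk M.isolated) :
    (componentEdges M M' K).Nonempty := by
  induction K using SimpleGraph.ConnectedComponent.ind with
  | _ v =>
    obtain ⟨w, hw⟩ := M.exists_mem_edges (v := v) (fun h => hK (by rw [h]))
    exact ⟨_, Or.inl hw, v, Sym2.mem_mk_left _ _, rfl⟩

theorem image_componentEdges (M M' : OddMatching S) :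
    componentEdges M M' '' {(unionGraph M M').connectedComponentMk M.isolated}ᶜ =
      altCycles M M' ∪ (fun e => {e}) '' happy M M' := by
  ext Z
  constructor
  · rintro ⟨K, hK, rfl⟩
    induction K using SimpleGraph.ConnectedComponent.ind with
    | _ v =>
      obtain ⟨w, hw⟩ := M.exists_mem_edges (v := v) (fun h => hK (by rw [h]; rfl))
      by_cases h' : s(v, w) ∈ M'.edges
      · exact Or.inr ⟨_, ⟨hw, h'⟩, (componentEdges_happy ⟨hw, h'⟩).symm⟩
      · exact Or.inl (componentEdges_mem_altCycles hw h'
          fun h => hK (SimpleGraph.ConnectedComponent.sound h.symm))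
  · rintro (hZ | ⟨e, he, rfl⟩)
    · obtain ⟨⟨K, hK, h⟩, -⟩ := exists_component_of_mem_altCycles hZ
      exact ⟨K, hK, h⟩
    · induction e with
      | _ a b =>
        exact ⟨_, fun h => not_reachable_happy he (Sym2.mem_mk_left _ _)
          (SimpleGraph.ConnectedComponent.exact h), componentEdges_happy he⟩

/-- Components are counted by their edge sets. That of the isolated point is set apart, as it may
have no edge; the others have nonempty, hence distinct, edge sets. -/
theorem numComponents_eq (M M' : OddMatching S) :
    numComponents M M' = 1 + (happy M M').ncard + (altCycles M M').ncard := by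
  have h1 : Set.InjOn (componentEdges M M')
      {(unionGraph M M').connectedComponentMk M.isolated}ᶜ := by
    intro K hK L hL h
    obtain ⟨e, he⟩ := componentEdges_nonempty hK
    exact componentEdges_unique he (h ▸ he)
  have h2 : Disjoint (altCycles M M') ((fun e : Sym2 S => ({e} : Set (Sym2 S))) '' happy M M') := by
    rw [Set.disjoint_left]
    rintro _ hZ ⟨e, he, rfl⟩
    exact (exists_component_of_mem_altCycles hZ).2 e rfl he
  have h3 := h1.ncard_image
  rw [image_componentEdges, Set.ncard_union_eq h2 (Set.toFinite _) (Set.toFinite _),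
    Set.ncard_image_of_injective _ Set.singleton_injective] at h3
  have h4 := Set.ncard_add_ncard_compl
    {(unionGraph M M').connectedComponentMk M.isolated} (Set.toFinite _) (Set.toFinite _)
  rw [Set.ncard_singleton] at h4
  unfold numComponents
  omega

theorem altCycles_self (M : OddMatching S) : altCycles M M = ∅ := by
  rw [Set.eq_empty_iff_forall_notMem]
  intro Z hZ
  obtain ⟨⟨K, hK, rfl⟩, h⟩ := exists_component_of_mem_altCycles hZ
  obtain ⟨e, he⟩ := componentEdges_nonempty hK
  exact h e he ⟨he.1.elim id id, he.1.elim id id⟩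

end OddMatching

/-! ### Counting components when an edge changes -/

namespace SimpleGraph

variable {V : Type*}

theorem reachable_sup_edge {G : SimpleGraph V} {x y a b : V}
    (h : (G ⊔ edge x y).Reachable a b) :
    G.Reachable a b ∨ (G.Reachable a x ∧ G.Reachable y b) ∨
      (G.Reachable a y ∧ G.Reachable x b) := by
  obtain ⟨p⟩ := h
  induction p with
  | nil => exact Or.inl Reachable.rfl
  | @cons u v w h q ih =>
    rw [sup_adj, edge_adj] at h
    rcases h with h | ⟨⟨rfl, rfl⟩ | ⟨rfl, rfl⟩, -⟩
    · rcases ih with ih | ⟨h1, h2⟩ | ⟨h1, h2⟩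
      · exact Or.inl (h.reachable.trans ih)
      · exact Or.inr (Or.inl ⟨h.reachable.trans h1, h2⟩)
      · exact Or.inr (Or.inr ⟨h.reachable.trans h1, h2⟩)
    · rcases ih with ih | ⟨-, h2⟩ | ⟨-, h2⟩
      · exact Or.inr (Or.inl ⟨Reachable.rfl, ih⟩)
      · exact Or.inr (Or.inl ⟨Reachable.rfl, h2⟩)
      · exact Or.inl h2
    · rcases ih with ih | ⟨-, h2⟩ | ⟨-, h2⟩
      · exact Or.inr (Or.inr ⟨Reachable.rfl, ih⟩)
      · exact Or.inl h2
      · exact Or.inr (Or.inr ⟨Reachable.rfl, h2⟩)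

/-- Adding one edge merges at most two components. -/
theorem card_connectedComponent_le_of_le_sup_edge [Finite V] {G G' : SimpleGraph V} {x y : V}
    (h : G' ≤ G ⊔ edge x y) :
    Nat.card G.ConnectedComponent ≤ Nat.card G'.ConnectedComponent + 1 := by
  have h1 := ConnectedComponent.card_le_card_of_le h
  have hinj : Set.InjOn (ConnectedComponent.map (Hom.ofLE (le_sup_left : G ≤ G ⊔ edge x y)))
      {G.connectedComponentMk x}ᶜ := by
    intro K hK L hL hKL
    induction K using ConnectedComponent.ind with
    | _ a =>
      induction L using ConnectedComponent.ind with
      | _ b =>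
        rcases reachable_sup_edge (ConnectedComponent.exact hKL) with h | ⟨h, -⟩ | ⟨-, h⟩
        · exact ConnectedComponent.sound h
        · exact absurd (ConnectedComponent.sound h) hK
        · exact absurd (ConnectedComponent.sound h.symm) hL
  have h2 := hinj.ncard_image.symm.trans_le (Set.ncard_le_card _)
  have h3 := Set.ncard_add_ncard_compl {G.connectedComponentMk x} (Set.toFinite _) (Set.toFinite _)
  rw [Set.ncard_singleton] at h3
  omega

/-- Reachability is compared instead of adjacency, since a flip may delete an edge whose endpoints
remain joined by a detour. -/
theorem card_connectedComponent_lt [Finite V] {G G' : SimpleGraph V} {x y : V}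
    (h : ∀ a b, G'.Reachable a b → G.Reachable a b) (hG : G.Reachable x y)
    (hG' : ¬ G'.Reachable x y) :
    Nat.card G.ConnectedComponent < Nat.card G'.ConnectedComponent := by
  classical
  have := Fintype.ofFinite G.ConnectedComponent
  have := Fintype.ofFinite G'.ConnectedComponent
  rw [Nat.card_eq_fintype_card, Nat.card_eq_fintype_card]
  let f : G'.ConnectedComponent → G.ConnectedComponent := Quot.map id h
  refine Fintype.card_lt_of_surjective_not_injective f ?_ fun hf => hG' ?_
  · intro K
    induction K using ConnectedComponent.ind with
    | _ a => exact ⟨G'.connectedComponentMk a, rfl⟩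
  · refine ConnectedComponent.exact (hf (a₁ := G'.connectedComponentMk x)
      (a₂ := G'.connectedComponentMk y) ?_)
    exact ConnectedComponent.sound hG

end SimpleGraph

/-! ### Sides of an edge and the effect of a flip -/

namespace PlaneEdge

variable {S : Finset EPlane}

/-- Two points that are not separated by a chord see the same points across it. -/
theorem cross_congr (hS : ConvexIndependent ℝ (fun v : S => (v : EPlane))) {a b u w : S}
    (hab : a ≠ b) (hu : u ∉ s(a, b)) (hw : w ∉ s(a, b)) (h : ¬ Cross s(a, b) s(u, w)) (v : S) :
    Cross s(a, b) s(u, v) ↔ Cross s(a, b) s(w, v) := by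
  obtain ⟨pos, hinj, -, hpos⟩ := exists_angular_order hS a
  rw [hpos _ _ _ _ hab] at h ⊢
  rw [hpos _ _ _ _ hab]
  simp only [Sym2.mem_iff, ← hinj.eq_iff] at hu hw
  unfold Interleave at *
  omega

theorem not_cross_of_mem (hS : ConvexIndependent ℝ (fun v : S => (v : EPlane))) {a b u v : S}
    (hab : a ≠ b) (hu : u ∈ s(a, b)) : ¬ Cross s(a, b) s(u, v) := by
  obtain ⟨pos, hinj, -, hpos⟩ := exists_angular_order hS a
  rw [hpos _ _ _ _ hab]
  rcases Sym2.mem_iff.1 hu with rfl | rfl <;> unfold Interleave <;> omega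

end PlaneEdge

namespace OddMatching

variable {S : Finset EPlane}

theorem mem_otherPart (hS : ConvexIndependent ℝ (fun v : S => (v : EPlane))) (M : OddMatching S)
    {a b v : S} (hab : a ≠ b) :
    v ∈ otherPart M s(a, b) ↔ PlaneEdge.Cross s(a, b) s(M.isolated, v) :=
  PlaneEdge.sOppSide_iff_cross hS hab

/-- A flip from `M` to `N` replaces the edge `y z` of `M` by `x y`, where `x` is the isolated point
of `M` and `z` that of `N`. -/
structure FlipAt (M N : OddMatching S) (y z : S) : Prop where
  mem : s(y, z) ∈ M.edges
  edges_eq : N.edges = insert s(M.isolated, y) (M.edges \ {s(y, z)})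
  isolated_eq : N.isolated = z

namespace FlipAt

variable {M N : OddMatching S} {y z : S}

theorem isolated_ne_left (h : FlipAt M N y z) : M.isolated ≠ y := fun hx =>
  M.isolated_notMem _ h.mem (hx ▸ Sym2.mem_mk_left _ _)

theorem isolated_ne_right (h : FlipAt M N y z) : M.isolated ≠ z := fun hx =>
  M.isolated_notMem _ h.mem (hx ▸ Sym2.mem_mk_right _ _)

theorem new_mem (h : FlipAt M N y z) : s(M.isolated, y) ∈ N.edges := by
  rw [h.edges_eq]; exact Set.mem_insert _ _

theorem new_notMem (_h : FlipAt M N y z) : s(M.isolated, y) ∉ M.edges := fun hm =>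
  M.isolated_notMem _ hm (Sym2.mem_mk_left _ _)

theorem old_notMem (h : FlipAt M N y z) : s(y, z) ∉ N.edges := fun hm => by
  refine N.isolated_notMem _ hm ?_
  rw [h.isolated_eq]
  exact Sym2.mem_mk_right _ _

theorem isFlip (h : FlipAt M N y z) : IsFlip M N :=
  ⟨_, h.mem, _, h.new_notMem, Sym2.mem_mk_left _ _, h.edges_eq⟩

theorem mem_iff_of_ne (h : FlipAt M N y z) {f : Sym2 S} (h1 : f ≠ s(M.isolated, y))
    (h2 : f ≠ s(y, z)) : f ∈ N.edges ↔ f ∈ M.edges := by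
  rw [h.edges_eq]
  simp [h1, h2]

theorem ncard_eq (h : FlipAt M N y z) : N.edges.ncard = M.edges.ncard := by
  rw [h.edges_eq, Set.ncard_exchange h.new_notMem h.mem]

/-- A common edge of two matchings that differ by a flip avoids the three points of the flip. -/
theorem notMem (h : FlipAt M N y z) {e : Sym2 S} (hM : e ∈ M.edges) (hN : e ∈ N.edges) :
    M.isolated ∉ e ∧ y ∉ e ∧ z ∉ e := by
  refine ⟨M.isolated_notMem _ hM, fun hy => ?_, fun hz => N.isolated_notMem _ hN
    (h.isolated_eq ▸ hz)⟩
  rw [M.eq_of_common_endpoint _ hM _ h.mem y hy (Sym2.mem_mk_left _ _)] at hN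
  exact h.old_notMem hN

/-- Neither `x y` nor `y z` crosses `e`, where `x` is the isolated point of `M`, so all three points
of the flip lie on the same side of `e`. -/
theorem otherPart_eq (hS : ConvexIndependent ℝ (fun v : S => (v : EPlane))) (h : FlipAt M N y z)
    {e : Sym2 S} (hM : e ∈ M.edges) (hN : e ∈ N.edges) :
    otherPart N e = otherPart M e ∧ M.isolated ∉ otherPart M e ∧ y ∉ otherPart M e := by
  obtain ⟨hx, hy, hz⟩ := h.notMem hM hN
  induction e with
  | _ a b =>
    have hab := M.ne_of_mem hM
    have h1 := N.crossingFree _ hN _ h.new_mem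
    have h2 := M.crossingFree _ hM _ h.mem
    have h3 := PlaneEdge.cross_congr hS hab hx hy h1
    have h4 := PlaneEdge.cross_congr hS hab hy hz h2
    refine ⟨?_, ?_, ?_⟩
    · ext v
      rw [mem_otherPart hS _ hab, mem_otherPart hS _ hab, h.isolated_eq, h3, h4]
    · rw [mem_otherPart hS _ hab, h3, Sym2.eq_swap (a := y)]
      exact h1
    · rwa [mem_otherPart hS _ hab]

end FlipAt

/-- The removed edge must be the one at `y`, the other endpoint of the new edge; otherwise two edges
of `N` would meet there. -/
theorem IsFlip.exists_flipAt {M N : OddMatching S} (h : IsFlip M N) :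
    ∃ y z, FlipAt M N y z := by
  obtain ⟨e, he, f, hf, ⟨y, rfl⟩, hN⟩ := h
  have hfN : s(M.isolated, y) ∈ N.edges := by rw [hN]; exact Set.mem_insert _ _
  have hxy := N.ne_of_mem hfN
  obtain ⟨z, hyz⟩ := M.exists_mem_edges hxy.symm
  have hne : s(y, z) ≠ s(M.isolated, y) := fun h => hf (h ▸ hyz)
  have hez : s(y, z) = e := by
    by_contra hc
    refine hne (N.eq_of_common_endpoint _ ?_ _ hfN y (Sym2.mem_mk_left _ _) (Sym2.mem_mk_right _ _))
    rw [hN]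
    exact Set.mem_insert_of_mem _ ⟨hyz, hc⟩
  subst hez
  refine ⟨y, z, hyz, hN, (N.eq_isolated fun g hg hz => ?_).symm⟩
  rw [hN] at hg
  rcases hg with rfl | ⟨hg, hgne⟩
  · rcases Sym2.mem_iff.1 hz with h | h
    · exact M.isolated_notMem _ hyz (h ▸ Sym2.mem_mk_right _ _)
    · exact M.ne_of_mem hyz h.symm
  · exact hgne (M.eq_of_common_endpoint _ hg _ hyz z hz (Sym2.mem_mk_right _ _))

namespace FlipAt

variable {M N : OddMatching S} {y z : S}

theorem numComponents_le (h : FlipAt M N y z) (M' : OddMatching S) :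
    numComponents M M' ≤ numComponents N M' + 1 := by
  refine SimpleGraph.card_connectedComponent_le_of_le_sup_edge (x := M.isolated) (y := y) ?_
  intro a b hab
  rw [unionGraph_adj, h.edges_eq] at hab
  rw [SimpleGraph.sup_adj, SimpleGraph.edge_adj, unionGraph_adj]
  rcases hab with (hab | hab) | hab
  · refine Or.inr ⟨Sym2.eq_iff.1 hab, ?_⟩
    rintro rfl
    exact h.isolated_ne_left (by
      rcases Sym2.eq_iff.1 hab with ⟨h1, h2⟩ | ⟨h1, h2⟩
      · exact h1.symm.trans h2
      · exact h2.symm.trans h1)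
  · exact Or.inl (Or.inl hab.1)
  · exact Or.inl (Or.inr hab)

theorem happy_of_old_mem (h : FlipAt M N y z) {M' : OddMatching S} (h' : s(y, z) ∈ M'.edges) :
    happy N M' = happy M M' \ {s(y, z)} := by
  have hxy : s(M.isolated, y) ∉ M'.edges := fun hm => by
    rw [Sym2.eq_swap] at hm
    exact h.isolated_ne_right (M'.eq_of_mem hm h')
  ext f
  simp only [happy, h.edges_eq, Set.mem_inter_iff, Set.mem_insert_iff, Set.mem_sdiff,
    Set.mem_singleton_iff]
  constructor
  · rintro ⟨rfl | hf, hf'⟩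
    · exact absurd hf' hxy
    · exact ⟨⟨hf.1, hf'⟩, hf.2⟩
  · rintro ⟨⟨h1, h2⟩, h3⟩
    exact ⟨Or.inr ⟨h1, h3⟩, h2⟩

theorem happy_of_new_mem (h : FlipAt M N y z) {M' : OddMatching S}
    (h' : s(M.isolated, y) ∈ M'.edges) :
    happy N M' = insert s(M.isolated, y) (happy M M') := by
  have hyz : s(y, z) ∉ M'.edges := fun hm => by
    rw [Sym2.eq_swap] at h'
    exact h.isolated_ne_right (M'.eq_of_mem h' hm)
  ext f
  simp only [happy, h.edges_eq, Set.mem_inter_iff, Set.mem_insert_iff, Set.mem_sdiff,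
    Set.mem_singleton_iff]
  constructor
  · rintro ⟨rfl | hf, hf'⟩
    · exact Or.inl rfl
    · exact Or.inr ⟨hf.1, hf'⟩
  · rintro (rfl | ⟨h1, h2⟩)
    · exact ⟨Or.inl rfl, h'⟩
    · exact ⟨Or.inr ⟨h1, fun h => hyz (h ▸ h2)⟩, h2⟩

theorem happy_of_notMem (h : FlipAt M N y z) {M' : OddMatching S} (h1 : s(y, z) ∉ M'.edges)
    (h2 : s(M.isolated, y) ∉ M'.edges) : happy N M' = happy M M' := by
  ext f
  by_cases hf1 : f = s(M.isolated, y)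
  · subst hf1; simp [happy, h2]
  by_cases hf2 : f = s(y, z)
  · subst hf2; simp [happy, h1]
  rw [happy, happy, Set.mem_inter_iff, h.mem_iff_of_ne hf1 hf2, Set.mem_inter_iff]

/-- The new edge was already in the union, so the flip only deletes edges from it. Being happy now,
the new edge is a component by itself, which cuts `y` off from `z`. -/
theorem numComponents_lt (h : FlipAt M N y z) {M' : OddMatching S}
    (h' : s(M.isolated, y) ∈ M'.edges) : numComponents M M' < numComponents N M' := by
  refine SimpleGraph.card_connectedComponent_lt (x := y) (y := z) ?_
    (unionGraph_adj.2 (Or.inl h.mem)).reachable fun hr => ?_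
  · intro a b hab
    refine hab.mono fun u v huv => ?_
    rw [unionGraph_adj] at huv ⊢
    rw [h.edges_eq] at huv
    rcases huv with (huv | huv) | huv
    · exact Or.inr (huv ▸ h')
    · exact Or.inl huv.1
    · exact Or.inr huv
  · have := mem_of_reachable_happy (M := N) ⟨h.new_mem, h'⟩ (Sym2.mem_mk_right _ _) hr
    rcases Sym2.mem_iff.1 this with h1 | h1
    · exact h.isolated_ne_right h1.symm
    · exact M.ne_of_mem h.mem h1.symm

end FlipAt

/-! ### Lower bound -/

/-- Each flip lowers the potential by at most one. -/
theorem potential_le_length {M M' : OddMatching S} (p : (flipGraph S).Walk M M')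
    (R : Set (Sym2 S)) (hR : R ⊆ happy M M') (hp : ∀ e ∈ R, ∃ N ∈ p.support, e ∉ N.edges) :
    numComponents M M' + 2 * R.ncard + M'.edges.ncard ≤
      p.length + 1 + 2 * (happy M M').ncard := by
  induction p generalizing R with
  | nil =>
    rename_i M
    have hR0 : R = ∅ := by
      rw [Set.eq_empty_iff_forall_notMem]
      intro e he
      obtain ⟨N, hN, heN⟩ := hp e he
      rw [SimpleGraph.Walk.support_nil, List.mem_singleton] at hN
      exact heN (hN ▸ (hR he).1)
    have h1 := numComponents_eq M M
    have h2 : happy M M = M.edges := Set.inter_self _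
    rw [altCycles_self, Set.ncard_empty, h2] at h1
    rw [hR0, Set.ncard_empty, h2, h1, SimpleGraph.Walk.length_nil]
    omega
  | @cons M N M' h q ih =>
    obtain ⟨y, z, hf⟩ := IsFlip.exists_flipAt h
    rw [SimpleGraph.Walk.length_cons]
    have hcomp := hf.numComponents_le M'
    have hq : ∀ e ∈ R, ∃ L ∈ q.support, e ∉ L.edges := by
      intro e he
      obtain ⟨L, hL, heL⟩ := hp e he
      rw [SimpleGraph.Walk.support_cons, List.mem_cons] at hL
      rcases hL with rfl | hL
      · exact absurd (hR he).1 heL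
      · exact ⟨L, hL, heL⟩
    -- Removing a happy edge lowers both `|happy|` and, at most, `|R|` by one, so the loss of one
    -- component is all that counts.
    by_cases h1 : s(y, z) ∈ M'.edges
    · have hh := hf.happy_of_old_mem h1
      have := ih (R \ {s(y, z)}) (by rw [hh]; exact Set.sdiff_subset_sdiff_left hR)
        (fun e he => hq e he.1)
      have h2 := Set.pred_ncard_le_ncard_sdiff_singleton R s(y, z)
      have h3 : (happy N M').ncard + 1 = (happy M M').ncard := by
        rw [hh]
        exact Set.ncard_sdiff_singleton_add_one (⟨hf.mem, h1⟩ : s(y, z) ∈ happy M M')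
          (Set.toFinite _)
      omega
    -- A new happy edge accounts for a drop of two, but the additional component gives one back.
    · by_cases h2 : s(M.isolated, y) ∈ M'.edges
      · have hh := hf.happy_of_new_mem h2
        have := ih R (by rw [hh]; exact hR.trans (Set.subset_insert _ _)) hq
        have h3 : (happy N M').ncard = (happy M M').ncard + 1 := by
          rw [hh, Set.ncard_insert_of_notMem (fun h => hf.new_notMem h.1) (Set.toFinite _)]
        have := hf.numComponents_lt h2
        omega
      · have hh := hf.happy_of_notMem h1 h2
        have := ih R (by rwa [hh]) hq
        rw [hh] at this
        omega

/-- As long as an edge is present, nothing changes on its side away from the isolated point. -/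
theorem mem_edges_iff_of_walk (hS : ConvexIndependent ℝ (fun v : S => (v : EPlane)))
    {M L : OddMatching S} (p : (flipGraph S).Walk M L) {e : Sym2 S}
    (he : ∀ N ∈ p.support, e ∈ N.edges) {f : Sym2 S} (hf : ∀ v ∈ f, v ∈ otherPart M e) :
    f ∈ M.edges ↔ f ∈ L.edges := by
  induction p with
  | nil => rfl
  | @cons M N L h q ih =>
    obtain ⟨y, z, hfl⟩ := IsFlip.exists_flipAt h
    have hM : e ∈ M.edges := he M (by simp)
    have hN : e ∈ N.edges := he N (by simp)
    obtain ⟨h1, h2, h3⟩ := hfl.otherPart_eq hS hM hN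
    rw [← ih (fun K hK => he K (by simp [hK])) (by rwa [h1])]
    refine (hfl.mem_iff_of_ne ?_ ?_).symm <;> rintro rfl
    · exact h2 (hf _ (Sym2.mem_mk_left _ _))
    · exact h3 (hf _ (Sym2.mem_mk_left _ _))

/-- An edge that is never removed freezes its far side, so `M` and `M'` agree there and the edge is
good. -/
theorem exists_notMem_of_badHappy (hS : ConvexIndependent ℝ (fun v : S => (v : EPlane)))
    {M M' : OddMatching S} (p : (flipGraph S).Walk M M') {e : Sym2 S}
    (he : e ∈ badHappy M M') : ∃ N ∈ p.support, e ∉ N.edges := by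
  by_contra! hc
  refine he.2 ⟨he.1, Or.inr fun f hf hfe => ?_⟩
  have := mem_edges_iff_of_walk hS p hc hfe
  rcases hf with hf | hf
  exacts [⟨hf, this.1 hf⟩, ⟨this.2 hf, hf⟩]

end OddMatching

/-! ### Upper bound: flips that make progress -/

namespace OddMatching

variable {S : Finset EPlane}

theorem exists_flipAt (M : OddMatching S) {y z : S} (hyz : s(y, z) ∈ M.edges)
    (hvis : ∀ e ∈ M.edges, ¬ PlaneEdge.Cross e s(M.isolated, y)) :
    ∃ N, FlipAt M N y z := by
  have hx : ∀ e ∈ M.edges, M.isolated ∉ e := M.isolated_notMem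
  have hxy : M.isolated ≠ y := fun h => hx _ hyz (h ▸ Sym2.mem_mk_left _ _)
  have hxz : M.isolated ≠ z := fun h => hx _ hyz (h ▸ Sym2.mem_mk_right _ _)
  have hyz' := M.ne_of_mem hyz
  have hy : ∀ e ∈ M.edges \ {s(y, z)}, y ∉ e := fun e he hye =>
    he.2 (M.eq_of_common_endpoint _ he.1 _ hyz y hye (Sym2.mem_mk_left _ _))
  have hz : ∀ e ∈ insert s(M.isolated, y) (M.edges \ {s(y, z)}), z ∉ e := by
    rintro e (rfl | he) hze
    · rcases Sym2.mem_iff.1 hze with h | h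
      exacts [hxz h.symm, hyz' h.symm]
    · exact he.2 (M.eq_of_common_endpoint _ he.1 _ hyz z hze (Sym2.mem_mk_right _ _))
  have hdis : ∀ e ∈ M.edges \ {s(y, z)}, ∀ v ∈ s(M.isolated, y), v ∉ e := by
    intro e he v hv
    rcases Sym2.mem_iff.1 hv with rfl | rfl
    exacts [hx e he.1, hy e he]
  let N : OddMatching S :=
    { edges := insert s(M.isolated, y) (M.edges \ {s(y, z)})
      not_isDiag := by
        rintro e (rfl | he)
        · rwa [Sym2.mk_isDiag_iff]
        · exact M.not_isDiag e he.1
      eq_of_common_endpoint := by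
        rintro e (rfl | he) f (rfl | hf) v hve hvf
        · rfl
        · exact absurd hvf (hdis f hf v hve)
        · exact absurd hve (hdis e he v hvf)
        · exact M.eq_of_common_endpoint e he.1 f hf.1 v hve hvf
      crossingFree := by
        rintro e (rfl | he) f (rfl | hf) hc
        · exact hc.1 rfl
        · exact hvis f hf.1 hc.symm
        · exact hvis e he.1 hc
        · exact M.crossingFree e he.1 f hf.1 hc
      existsUnique_isolated := by
        refine ⟨z, hz, fun v hv => ?_⟩
        have hvx : v ≠ M.isolated := fun h =>
          hv _ (Set.mem_insert _ _) (h ▸ Sym2.mem_mk_left _ _)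
        obtain ⟨w, hw⟩ := M.exists_mem_edges hvx
        by_cases h : s(v, w) = s(y, z)
        · have hv' : v ∈ s(y, z) := h ▸ Sym2.mem_mk_left _ _
          rcases Sym2.mem_iff.1 hv' with rfl | rfl
          · exact absurd (Sym2.mem_mk_right _ _) (hv _ (Set.mem_insert _ _))
          · rfl
        · exact absurd (Sym2.mem_mk_left _ _) (hv _ (Set.mem_insert_of_mem _ ⟨hw, h⟩)) }
  exact ⟨N, hyz, rfl, (N.eq_isolated hz).symm⟩

namespace FlipAt

variable {M N : OddMatching S} {y z : S}

theorem crossingFree (h : FlipAt M N y z) {M' : OddMatching S}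
    (hcf : PlaneEdge.CrossingFree (M.edges ∪ M'.edges))
    (hvis : ∀ e ∈ M.edges ∪ M'.edges, ¬ PlaneEdge.Cross e s(M.isolated, y)) :
    PlaneEdge.CrossingFree (N.edges ∪ M'.edges) := by
  have hsub : ∀ e ∈ N.edges ∪ M'.edges, e = s(M.isolated, y) ∨ e ∈ M.edges ∪ M'.edges := by
    rw [h.edges_eq]
    rintro e ((rfl | he) | he)
    exacts [Or.inl rfl, Or.inr (Or.inl he.1), Or.inr (Or.inr he)]
  intro e he f hf hc
  rcases hsub e he with rfl | he' <;> rcases hsub f hf with rfl | hf'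
  · exact hc.1 rfl
  · exact hvis f hf' hc.symm
  · exact hvis e he' hc
  · exact hcf e he' f hf' hc

/-- The flip takes place on the near side of every good edge that it keeps, so the far side of that
edge does not change. -/
theorem goodHappy_subset (hS : ConvexIndependent ℝ (fun v : S => (v : EPlane)))
    (h : FlipAt M N y z) {M' : OddMatching S} (hyz : s(y, z) ∉ goodHappy M M') :
    goodHappy M M' ⊆ goodHappy N M' := by
  rintro e ⟨he, hgood⟩
  have hM := he.1
  have hN : e ∈ N.edges := by
    rw [h.edges_eq]
    exact Set.mem_insert_of_mem _ ⟨hM, fun h' => hyz (h' ▸ ⟨he, hgood⟩)⟩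
  obtain ⟨h1, h2, h3⟩ := h.otherPart_eq hS hM hN
  refine ⟨⟨hN, he.2⟩, hgood.imp_right fun hg f hf hfe => ?_⟩
  rw [h1] at hfe
  have hne1 : f ≠ s(M.isolated, y) := by
    rintro rfl
    exact h2 (hfe _ (Sym2.mem_mk_left _ _))
  have hne2 : f ≠ s(y, z) := by
    rintro rfl
    exact h3 (hfe _ (Sym2.mem_mk_left _ _))
  have hiff := h.mem_iff_of_ne hne1 hne2
  have hfh := hg f (hf.imp_left hiff.1) hfe
  exact ⟨hiff.2 hfh.1, hfh.2⟩

/-- Connecting the isolated point to another component. -/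
theorem numComponents_lt_of_not_reachable (h : FlipAt M N y z) {M' : OddMatching S}
    (hx : ¬ (unionGraph M M').Reachable M.isolated y) :
    numComponents N M' < numComponents M M' := by
  have hle : (unionGraph M M').deleteEdges {s(y, z)} ≤ unionGraph N M' := by
    intro a b hab
    rw [SimpleGraph.deleteEdges_adj, unionGraph_adj] at hab
    rw [unionGraph_adj, h.edges_eq]
    exact hab.1.imp_left fun hm => Set.mem_insert_of_mem _ ⟨hm, hab.2⟩
  -- Losing `y z` splits nothing: the edge is still in `M'`, or it is not a bridge.
  have hyz : (unionGraph N M').Reachable y z := by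
    by_cases h' : s(y, z) ∈ M'.edges
    · exact (unionGraph_adj.2 (Or.inr h')).reachable
    · exact (reachable_deleteEdges h.mem h' hx).mono hle
  refine SimpleGraph.card_connectedComponent_lt (x := M.isolated) (y := y) ?_
    (unionGraph_adj.2 (Or.inl h.new_mem)).reachable hx
  rintro a b ⟨p⟩
  induction p with
  | nil => rfl
  | @cons u v w hadj q ih =>
    refine SimpleGraph.Reachable.trans ?_ ih
    by_cases he : s(u, v) = s(y, z)
    · rcases Sym2.eq_iff.1 he with ⟨rfl, rfl⟩ | ⟨rfl, rfl⟩
      exacts [hyz, hyz.symm]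
    · refine (hle ?_).reachable
      rw [SimpleGraph.deleteEdges_adj]
      exact ⟨hadj, he⟩

theorem numComponents_le_add_one (h : FlipAt M N y z) (M' : OddMatching S) :
    numComponents N M' ≤ numComponents M M' + 1 := by
  refine SimpleGraph.card_connectedComponent_le_of_le_sup_edge (x := y) (y := z) ?_
  intro a b hab
  rw [SimpleGraph.sup_adj, SimpleGraph.edge_adj, unionGraph_adj, h.edges_eq]
  by_cases he : s(a, b) = s(y, z)
  · exact Or.inr ⟨Sym2.eq_iff.1 he, hab.ne⟩
  · exact Or.inl ((unionGraph_adj.1 hab).imp_left fun hm => Set.mem_insert_of_mem _ ⟨hm, he⟩)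

end FlipAt

/-- In a region closed under adjacency that contains an edge which is not good, a longest such edge
has an endpoint visible from the isolated point. -/
theorem exists_visible (hS : ConvexIndependent ℝ (fun v : S => (v : EPlane)))
    {M M' : OddMatching S} (hcf : PlaneEdge.CrossingFree (M.edges ∪ M'.edges))
    {pos : S → ℕ} (hinj : Function.Injective pos) (hx0 : pos M.isolated = 0)
    (hpos : ∀ a b c d, a ≠ b →
      (PlaneEdge.Cross s(a, b) s(c, d) ↔ Interleave (pos a) (pos b) (pos c) (pos d)))
    {V : Set S} (hxV : M.isolated ∉ V)
    (hcl : ∀ v w, s(v, w) ∈ M.edges ∪ M'.edges → v ∈ V → w ∈ V)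
    (hV : ∀ i ∈ V, ∀ k l, 0 < pos k → pos k < pos i → pos i < pos l → k ∈ V ∨ l ∈ V)
    (hex : ∃ v ∈ V, ∃ w, s(v, w) ∈ M.edges ∪ M'.edges ∧ s(v, w) ∉ goodHappy M M') :
    ∃ y ∈ V, ∃ z, s(y, z) ∈ M.edges ∧ s(y, z) ∉ goodHappy M M' ∧
      ∀ e ∈ M.edges ∪ M'.edges, ¬ PlaneEdge.Cross e s(M.isolated, y) := by
  have hne : ∀ {v w}, s(v, w) ∈ M.edges ∪ M'.edges → v ≠ w := fun h => (unionGraph_adj.2 h).ne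
  -- Edges that are not good, directed by increasing position. One with the largest gap is taken,
  -- and its first endpoint will be visible.
  let A : Set (S × S) := {p | p.1 ∈ V ∧ pos p.1 < pos p.2 ∧
    s(p.1, p.2) ∈ M.edges ∪ M'.edges ∧ s(p.1, p.2) ∉ goodHappy M M'}
  have hA : A.Nonempty := by
    obtain ⟨v, hv, w, hvw, hg⟩ := hex
    rcases lt_trichotomy (pos v) (pos w) with h | h | h
    · exact ⟨(v, w), hv, h, hvw, hg⟩
    · exact absurd (hinj h) (hne hvw)
    · exact ⟨(w, v), hcl _ _ hvw hv, h, by rwa [Sym2.eq_swap], by rwa [Sym2.eq_swap]⟩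
  obtain ⟨⟨i, j⟩, ⟨hiV, hij, hf, hfg⟩, hmax⟩ :=
    A.exists_max_image (fun p => pos p.2 - pos p.1) (Set.toFinite _) hA
  simp only at hiV hij hf hfg hmax
  obtain ⟨w, hw⟩ := M.exists_mem_edges (v := i) (fun h => hxV (h ▸ hiV))
  refine ⟨i, hiV, w, hw, fun hg => ?_, ?_⟩
  · exact hfg (eq_of_mem_happy hg.1 hf (Sym2.mem_mk_left _ _) (Sym2.mem_mk_left _ _) ▸ hg)
  intro g hg hc
  obtain ⟨k, l, rfl, hkl⟩ : ∃ k l, g = s(k, l) ∧ pos k < pos l := by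
    induction g with
    | _ k l =>
      rcases lt_trichotomy (pos k) (pos l) with h | h | h
      · exact ⟨k, l, rfl, h⟩
      · exact absurd (hinj h) (hne hg)
      · exact ⟨l, k, Sym2.eq_swap, h⟩
  have hcr : ∀ v, PlaneEdge.Cross s(k, l) s(M.isolated, v) ↔
      0 < pos k ∧ pos k < pos v ∧ pos v < pos l := by
    intro v
    rw [hpos _ _ _ _ (hne hg), hx0]
    unfold Interleave
    omega
  obtain ⟨hk0, hki, hil⟩ := (hcr i).1 hc
  -- By `hV`, an edge that hides a point of `V` from the isolated point has an endpoint in `V`,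
  -- hence both.
  have hkV : k ∈ V := by
    rcases hV i hiV k l hk0 hki hil with h | h
    · exact h
    · exact hcl l k (by rwa [Sym2.eq_swap]) h
  have hjl : pos j ≤ pos l := by
    have := hcf _ hg _ hf
    rw [hpos _ _ _ _ (hne hg)] at this
    unfold Interleave at this
    omega
  -- The blocking edge `k l` spans more than `i j`, so by maximality it can only be good. A hull
  -- edge blocks nothing; otherwise `i j` and its far side lie beyond `k l`, where all is happy, and
  -- `i j` would be good.
  by_cases hgg : s(k, l) ∈ goodHappy M M'
  · have hjl' : pos j ≠ pos l := by
      intro h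
      have h1 := eq_of_mem_happy hgg.1 hf (v := l) (Sym2.mem_mk_right _ _)
        (hinj h ▸ Sym2.mem_mk_right _ _)
      exact hfg (h1 ▸ hgg)
    rcases hgg with ⟨hgh, hH | hpart⟩
    · exact hH.not_cross hS (hne hg) hc
    · have hcf' : ∀ v, v ∈ otherPart M s(i, j) → v ∈ otherPart M s(k, l) := by
        intro v hv
        rw [mem_otherPart hS _ (hne hg), hcr]
        rw [mem_otherPart hS _ (hne hf), hpos _ _ _ _ (hne hf), hx0] at hv
        unfold Interleave at hv
        omega
      have hfh : s(i, j) ∈ happy M M' := by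
        refine hpart _ hf fun v hv => ?_
        rw [mem_otherPart hS _ (hne hg), hcr]
        rcases Sym2.mem_iff.1 hv with rfl | rfl <;> omega
      exact hfg ⟨hfh, Or.inr fun f' hf' hf'p => hpart f' hf' fun v hv => hcf' v (hf'p v hv)⟩
  · have := hmax (k, l) ⟨hkV, hkl, hg, hgg⟩
    simp only at this
    omega

theorem not_reachable_of_closed {M M' : OddMatching S} {V : Set S} {x y : S} (hx : x ∉ V)
    (hcl : ∀ v w, s(v, w) ∈ M.edges ∪ M'.edges → v ∈ V → w ∈ V) (hy : y ∈ V) :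
    ¬ (unionGraph M M').Reachable x y := by
  intro h
  obtain ⟨p⟩ := h.symm
  induction p with
  | nil => exact hx hy
  | cons h' q ih => exact ih hx (hcl _ _ (unionGraph_adj.1 h') hy) ⟨q.reverse⟩

/-- The flip from `M` to `N` lowers the potential towards `M'`, and keeps the union plane. -/
def IsProgress (M M' N : OddMatching S) : Prop :=
  IsFlip M N ∧ N.edges.ncard = M.edges.ncard ∧ PlaneEdge.CrossingFree (N.edges ∪ M'.edges) ∧
    numComponents N M' + 1 + 2 * (goodHappy M M').ncard ≤
      numComponents M M' + 2 * (goodHappy N M').ncard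

/-- The edge at the visible point is not good and lies outside the component of the isolated point.
The flip there merges two components and loses no good edge. -/
theorem exists_isProgress_of_region (hS : ConvexIndependent ℝ (fun v : S => (v : EPlane)))
    {M M' : OddMatching S} (hcf : PlaneEdge.CrossingFree (M.edges ∪ M'.edges))
    {pos : S → ℕ} (hinj : Function.Injective pos) (hx0 : pos M.isolated = 0)
    (hpos : ∀ a b c d, a ≠ b →
      (PlaneEdge.Cross s(a, b) s(c, d) ↔ Interleave (pos a) (pos b) (pos c) (pos d)))
    {V : Set S} (hxV : M.isolated ∉ V)
    (hcl : ∀ v w, s(v, w) ∈ M.edges ∪ M'.edges → v ∈ V → w ∈ V)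
    (hV : ∀ i ∈ V, ∀ k l, 0 < pos k → pos k < pos i → pos i < pos l → k ∈ V ∨ l ∈ V)
    (hex : ∃ v ∈ V, ∃ w, s(v, w) ∈ M.edges ∪ M'.edges ∧ s(v, w) ∉ goodHappy M M') :
    ∃ N, IsProgress M M' N := by
  obtain ⟨y, hy, z, hyz, hg, hvis⟩ := exists_visible hS hcf hinj hx0 hpos hxV hcl hV hex
  obtain ⟨N, hN⟩ := M.exists_flipAt hyz fun e he => hvis e (Or.inl he)
  refine ⟨N, hN.isFlip, hN.ncard_eq, hN.crossingFree hcf hvis, ?_⟩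
  have h1 := hN.numComponents_lt_of_not_reachable (M' := M')
    (not_reachable_of_closed hxV hcl hy)
  have h2 := Set.ncard_le_ncard (hN.goodHappy_subset hS hg) (Set.toFinite _)
  omega

/-- After the flip the isolated point is `q`, so the far side of `x p` (with `x` the isolated point
of `M`) is the one that `hpart` declares happy. The gain of a good edge outweighs the at most one
new component. -/
theorem exists_isProgress_of_path (hS : ConvexIndependent ℝ (fun v : S => (v : EPlane)))
    {M M' : OddMatching S} (hcf : PlaneEdge.CrossingFree (M.edges ∪ M'.edges)) {p q : S}
    (hp : s(M.isolated, p) ∈ M'.edges) (hq : s(p, q) ∈ M.edges)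
    (hpart : ∀ f ∈ M.edges ∪ M'.edges,
      (∀ v ∈ f, PlaneEdge.Cross s(M.isolated, p) s(q, v)) → f ∈ happy M M') :
    ∃ N, IsProgress M M' N := by
  have hvis : ∀ e ∈ M.edges ∪ M'.edges, ¬ PlaneEdge.Cross e s(M.isolated, p) :=
    fun e he => hcf e he _ (Or.inr hp)
  obtain ⟨N, hN⟩ := M.exists_flipAt hq fun e he => hvis e (Or.inl he)
  refine ⟨N, hN.isFlip, hN.ncard_eq, hN.crossingFree hcf hvis, ?_⟩
  have hpq : s(p, q) ∉ M'.edges := fun h => by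
    rw [Sym2.eq_swap] at hp
    exact hN.isolated_ne_right (M'.eq_of_mem hp h)
  have hh := hN.happy_of_new_mem hp
  have hnew : s(M.isolated, p) ∈ goodHappy N M' := by
    refine ⟨⟨hN.new_mem, hp⟩, Or.inr fun f hf hfp => ?_⟩
    by_cases hfe : f = s(M.isolated, p)
    · exact hfe ▸ ⟨hN.new_mem, hp⟩
    rw [hh]
    refine Set.mem_insert_of_mem _ (hpart f (hf.imp_left fun hf => ?_) fun v hv => ?_)
    · rw [hN.edges_eq] at hf
      exact (hf.resolve_left hfe).1
    · have := hfp v hv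
      rwa [mem_otherPart hS _ hN.isolated_ne_left, hN.isolated_eq] at this
  have h1 := hN.numComponents_le_add_one M'
  have h2 := Set.ncard_le_ncard (Set.insert_subset hnew
    (hN.goodHappy_subset hS fun h => hpq h.1.2)) (Set.toFinite _)
  rw [Set.ncard_insert_of_notMem (fun h => hN.new_notMem h.1.1) (Set.toFinite _)] at h2
  omega

theorem exists_isProgress (hS : ConvexIndependent ℝ (fun v : S => (v : EPlane)))
    {M M' : OddMatching S} (hcf : PlaneEdge.CrossingFree (M.edges ∪ M'.edges)) (hne : M ≠ M') :
    ∃ N, IsProgress M M' N := by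
  obtain ⟨pos, hinj, hx0, hpos⟩ := PlaneEdge.exists_angular_order hS M.isolated
  by_cases hxx : M.isolated = M'.isolated
  · have hcl : ∀ v w, s(v, w) ∈ M.edges ∪ M'.edges → w ≠ M.isolated := by
      rintro v w (h | h) rfl
      · exact M.isolated_notMem _ h (Sym2.mem_mk_right _ _)
      · exact M'.isolated_notMem _ h (hxx ▸ Sym2.mem_mk_right _ _)
    -- Equal isolated points make the path trivial, so all other points form an admissible region.
    refine exists_isProgress_of_region hS hcf hinj hx0 hpos (V := {v | v ≠ M.isolated})
      (fun h => h rfl) (fun v w h _ => hcl v w h) ?_ ?_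
    · rintro i - k l hk - -
      refine Or.inl fun h => ?_
      rw [h, hx0] at hk
      exact hk.ne rfl
    · obtain ⟨e, he, heh⟩ : ∃ e ∈ M.edges ∪ M'.edges, e ∉ happy M M' := by
        by_contra! hc
        exact hne (OddMatching.ext (Set.Subset.antisymm (fun e he => (hc e (Or.inl he)).2)
          fun e he => (hc e (Or.inr he)).1))
      induction e with
      | _ v w =>
        exact ⟨w, hcl v w he, v, by rwa [Sym2.eq_swap], fun h => heh (by
          rw [Sym2.eq_swap]; exact h.1)⟩
  · obtain ⟨p, hp⟩ := M'.exists_mem_edges hxx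
    have hxp := M'.ne_of_mem hp
    obtain ⟨q, hq⟩ := M.exists_mem_edges hxp.symm
    by_cases hpart : ∀ f ∈ M.edges ∪ M'.edges,
        (∀ v ∈ f, PlaneEdge.Cross s(M.isolated, p) s(q, v)) → f ∈ happy M M'
    · exact exists_isProgress_of_path hS hcf hp hq hpart
    push Not at hpart
    obtain ⟨f, hf, hfV, hfh⟩ := hpart
    have hnot : ∀ v, PlaneEdge.Cross s(M.isolated, p) s(q, v) → v ∉ s(M.isolated, p) := by
      intro v hv hm
      rw [Sym2.eq_swap (a := q)] at hv
      exact PlaneEdge.not_cross_of_mem hS hxp hm hv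
    -- The region is the side of `x p` opposite `q`. No edge of the union leaves it: none crosses `x
    -- p`, and the edges at `x` and `p` are only `x p` and `p q`.
    refine exists_isProgress_of_region hS hcf hinj hx0 hpos
      (V := {v | PlaneEdge.Cross s(M.isolated, p) s(q, v)})
      (fun h => hnot _ h (Sym2.mem_mk_left _ _)) ?_ ?_ ?_
    · intro v w hvw hv
      have hv' := hnot v hv
      have hw' : w ∉ s(M.isolated, p) := by
        intro hw
        rw [Sym2.eq_swap] at hvw
        rcases Sym2.mem_iff.1 hw with rfl | rfl
        · have h := hvw.resolve_left fun h => M.isolated_notMem _ h (Sym2.mem_mk_left _ _)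
          exact hv' (M'.eq_of_mem h hp ▸ Sym2.mem_mk_right _ _)
        · rcases hvw with h | h
          · obtain rfl := M.eq_of_mem h hq
            have hv2 : PlaneEdge.Cross s(M.isolated, w) s(v, v) := hv
            rw [hpos _ _ _ _ hxp] at hv2
            unfold Interleave at hv2
            omega
          · rw [Sym2.eq_swap] at hp
            exact hv' (M'.eq_of_mem h hp ▸ Sym2.mem_mk_left _ _)
      have := PlaneEdge.cross_congr hS hxp hv' hw' (hcf _ (Or.inr hp) _ hvw) q
      rw [Sym2.eq_swap (a := v), Sym2.eq_swap (a := w)] at this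
      exact this.1 hv
    · intro i hi k l hk hki hil
      -- The region consists of the positions either below or above that of `p`; it contains `k` in
      -- the first case and `l` in the second.
      simp only [Set.mem_ofPred_eq, hpos _ _ _ _ hxp, hx0] at hi ⊢
      unfold Interleave at *
      omega
    · induction f with
      | _ v w => exact ⟨v, hfV v (Sym2.mem_mk_left _ _), w, hf, fun h => hfh h.1⟩

theorem ncard_goodHappy_add_ncard_badHappy (M M' : OddMatching S) :
    (badHappy M M').ncard + (goodHappy M M').ncard = (happy M M').ncard :=
  Set.ncard_sdiff_add_ncard_of_subset (fun _ h => h.1) (Set.toFinite _)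

/-- The hypothesis `hk` says, without subtraction, that the potential is at most `k`. -/
theorem exists_walk_of_potential_le (hS : ConvexIndependent ℝ (fun v : S => (v : EPlane)))
    {M' : OddMatching S} (k : ℕ) (M : OddMatching S)
    (hcf : PlaneEdge.CrossingFree (M.edges ∪ M'.edges))
    (hk : numComponents M M' + M.edges.ncard ≤ k + 1 + 2 * (goodHappy M M').ncard) :
    ∃ p : (flipGraph S).Walk M M', p.length ≤ k := by
  induction k generalizing M with
  | zero =>
    by_cases hne : M = M'
    · subst hne
      exact ⟨SimpleGraph.Walk.nil, le_rfl⟩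
    -- A further progress flip would make the potential of `N` negative, against its expression as a
    -- sum of cardinalities.
    obtain ⟨N, -, h1, -, h2⟩ := exists_isProgress hS hcf hne
    have h3 := numComponents_eq N M'
    have h4 := ncard_goodHappy_add_ncard_badHappy N M'
    have h5 := ncard_cycleEdges_add_ncard_pathEdges N M'
    omega
  | succ k ih =>
    by_cases hne : M = M'
    · subst hne
      exact ⟨SimpleGraph.Walk.nil, Nat.zero_le _⟩
    obtain ⟨N, h0, h1, hcf', h2⟩ := exists_isProgress hS hcf hne
    obtain ⟨p, hp⟩ := ih N hcf' (by omega)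
    have hadj : (flipGraph S).Adj M N := h0
    exact ⟨SimpleGraph.Walk.cons hadj p, by rw [SimpleGraph.Walk.length_cons]; omega⟩

theorem ncard_edges_eq_of_walk {M M' : OddMatching S} (p : (flipGraph S).Walk M M') :
    M.edges.ncard = M'.edges.ncard := by
  induction p with
  | nil => rfl
  | cons h q ih =>
    obtain ⟨y, z, hf⟩ := IsFlip.exists_flipAt h
    rw [← ih, hf.ncard_eq]

end OddMatching

/-! ### The distance formula -/

theorem mainTheorem6 (S : Finset EPlane)
    (hS : ConvexIndependent ℝ (fun v : S => (v : EPlane)))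
    (M M' : OddMatching S)
    (hcf : PlaneEdge.CrossingFree (M.edges ∪ M'.edges)) :
    (OddMatching.flipGraph S).Reachable M M' ∧
      (OddMatching.flipGraph S).dist M M' =
        2 * (OddMatching.badHappy M M').ncard
          + (OddMatching.cycleEdges M M').ncard
          + (OddMatching.altCycles M M').ncard
          + (OddMatching.pathEdges M M').ncard := by
  have h1 := OddMatching.numComponents_eq M M'
  have h2 := OddMatching.ncard_goodHappy_add_ncard_badHappy M M'
  have h3 := OddMatching.ncard_cycleEdges_add_ncard_pathEdges M M'
  obtain ⟨p, hp⟩ := OddMatching.exists_walk_of_potential_le hS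
    (2 * (OddMatching.badHappy M M').ncard + (OddMatching.cycleEdges M M').ncard
      + (OddMatching.altCycles M M').ncard + (OddMatching.pathEdges M M').ncard) M hcf (by omega)
  refine ⟨⟨p⟩, le_antisymm ((SimpleGraph.dist_le p).trans hp) ?_⟩
  obtain ⟨q, hq⟩ := SimpleGraph.Reachable.exists_walk_length_eq_dist ⟨p⟩
  -- With `R` the set of bad edges, `|happy| - |R|` is the number of good edges, so the bound is the
  -- potential itself.
  have h4 := OddMatching.potential_le_length q (OddMatching.badHappy M M') (fun _ h => h.1)
    (fun e he => OddMatching.exists_notMem_of_badHappy hS q he)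
  have h5 := OddMatching.ncard_edges_eq_of_walk q
  omega
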